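/- Let $H$ be a complex Hilbert space and let $M\subseteq B(H)$ be a weak* closed subalgebra (resp. a weak* closed linear subspace closed under the Jordan product $a\circ b=\frac12(ab+ba)$) which is unital, that is, has an identity element of norm at most $1$ for its product (so of norm $1$ unless $M=\{0\}$; it need not be the identity operator of $H$). Identify $M_n(B(H))$ with $B(H^n)$, and call an operator $T$ real positive if $T+T^*\ge 0$. Let $\Phi:M\to M$ be a linear map which is weak* continuous, completely contractive (all the entrywise amplifications $M_n(M)\to M_n(M)$, $n\in\mathbb N$, are contractive for the norms of $B(H^n)$) and real completely positive (all these amplifications map real positive matrices to real positive matrices). Let $M^\Phi=\{x\in M:\Phi(x)=x\}$. Then there is a linear map $P:M\to M$ with $P\circ P=P$ and $P(M)=M^\Phi$ which is real completely positive and completely contractive, and such that $M^\Phi$ with the new product $(x,y)\mapsto P(xy)$ (resp. $(x,y)\mapsto P(x\circ y)$) is a unital dual operator algebra (resp. a unital Jordan operator algebra), in the following sense. In the associative case, $M^\Phi$ is weak* closed in $B(H)$, and there are a Hilbert space $K$, a weak* closed subalgebra $N\subseteq B(K)$ with an identity element of norm at most $1$, and a linear bijection $\pi:M^\Phi\to N$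 that is completely isometric, a homeomorphism for the relative weak* topologies, and satisfies $\pi(P(xy))=\pi(x)\pi(y)$ for all $x,y\in M^\Phi$. In the Jordan case, there are a Hilbert space $K$, a norm closed subspace $N\subseteq B(K)$ that is closed under the Jordan product and has an identity element of norm at most $1$ for it, and a completely isometric linear bijection $\pi:M^\Phi\to N$ with $\pi(P(x\circ y))=\pi(x)\circ\pi(y)$ for all $x,y\in M^\Phi$. -/

import Mathlib

namespace OperatorAlg

noncomputable section

open scoped InnerProductSpace Topology

universe u

set_option linter.unusedSectionVars false

section Operators

variable {H : Type u} [NormedAddCommGroup H] [InnerProductSpace ℂ H] [CompleteSpace H]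

/-- The weak* topology of `B(H)`, the dual of the trace class operators: the coarsest topology
for which `x ↦ ∑ₙ ⟪ηₙ, x ξₙ⟫` is continuous for all square summable sequences `ξ`, `η` in `H`. -/
abbrev weakStar (H : Type u) [NormedAddCommGroup H] [InnerProductSpace ℂ H] [CompleteSpace H] :
    TopologicalSpace (H →L[ℂ] H) :=
  TopologicalSpace.induced
    (fun (x : H →L[ℂ] H) (p : lp (fun _ : ℕ => H) 2 × lp (fun _ : ℕ => H) 2) =>
      ∑' n, ⟪p.2 n, x (p.1 n)⟫_ℂ)
    Pi.topologicalSpace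

/-- The relative weak* topology on a subspace of `B(H)`. -/
abbrev relWeakStar (S : Submodule ℂ (H →L[ℂ] H)) : TopologicalSpace S :=
  TopologicalSpace.induced (fun x : S => (x : H →L[ℂ] H)) (weakStar H)

/-- `S` is weak* closed in `B(H)`. -/
def IsWeakStarClosed (S : Submodule ℂ (H →L[ℂ] H)) : Prop :=
  IsClosed[weakStar H] (S : Set (H →L[ℂ] H))

/-- The operator on the Hilbert space direct sum `Hⁿ` defined by an `n × n` matrix of operators
on `H`; this is the identification of `Mₙ(B(H))` with `B(Hⁿ)`. -/
def matOp {n : ℕ} (a : Matrix (Fin n) (Fin n) (H →L[ℂ] H)) :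
    PiLp 2 (fun _ : Fin n => H) →L[ℂ] PiLp 2 (fun _ : Fin n => H) :=
  ((PiLp.continuousLinearEquiv 2 ℂ (fun _ : Fin n => H)).symm :
      (Fin n → H) →L[ℂ] PiLp 2 (fun _ : Fin n => H)) ∘L
    ContinuousLinearMap.pi (fun i => ∑ j, (a i j) ∘L PiLp.proj 2 (fun _ : Fin n => H) j)

theorem matOp_apply {n : ℕ} (a : Matrix (Fin n) (Fin n) (H →L[ℂ] H))
    (v : PiLp 2 (fun _ : Fin n => H)) (i : Fin n) : matOp a v i = ∑ j, a i j (v j) := by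
  simp [matOp]

/-- The operator on `Hⁿ` of an `n × n` matrix with entries in a subspace of `B(H)`. -/
def subMatOp (S : Submodule ℂ (H →L[ℂ] H)) {n : ℕ} (a : Matrix (Fin n) (Fin n) S) :
    PiLp 2 (fun _ : Fin n => H) →L[ℂ] PiLp 2 (fun _ : Fin n => H) :=
  matOp (a.map (fun x : S => (x : H →L[ℂ] H)))

/-- `T` is real positive (accretive): `T + T* ≥ 0`. -/
def IsRealPositive {E : Type u} [NormedAddCommGroup E] [InnerProductSpace ℂ E] [CompleteSpace E]
    (T : E →L[ℂ] E) : Prop :=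
  (T + ContinuousLinearMap.adjoint T).IsPositive

end Operators

section Maps

variable {H K : Type u} [NormedAddCommGroup H] [InnerProductSpace ℂ H] [CompleteSpace H]
  [NormedAddCommGroup K] [InnerProductSpace ℂ K] [CompleteSpace K]
  {S : Submodule ℂ (H →L[ℂ] H)} {R : Submodule ℂ (K →L[ℂ] K)}

/-- Every entrywise amplification of `T` takes real positive matrices to real positive ones. -/
def IsRealCompletelyPositive (T : S →ₗ[ℂ] R) : Prop :=
  ∀ (n : ℕ) (a : Matrix (Fin n) (Fin n) S),
    IsRealPositive (subMatOp S a) → IsRealPositive (subMatOp R (a.map T))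

/-- Every entrywise amplification of `T` is contractive. -/
def IsCompletelyContractive (T : S →ₗ[ℂ] R) : Prop :=
  ∀ (n : ℕ) (a : Matrix (Fin n) (Fin n) S), ‖subMatOp R (a.map T)‖ ≤ ‖subMatOp S a‖

/-- Every entrywise amplification of `T` is isometric. -/
def IsCompletelyIsometric (T : S →ₗ[ℂ] R) : Prop :=
  ∀ (n : ℕ) (a : Matrix (Fin n) (Fin n) S), ‖subMatOp R (a.map T)‖ = ‖subMatOp S a‖

/-- `T` is continuous for the relative weak* topologies. -/
def IsWeakStarContinuous (T : S →ₗ[ℂ] R) : Prop :=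
  Continuous[relWeakStar S, relWeakStar R] T

end Maps

section Algebras

variable {H : Type u} [NormedAddCommGroup H] [InnerProductSpace ℂ H] [CompleteSpace H]

/-- The Jordan product `a ∘ b = (ab + ba)/2` of operators. -/
def jordanMul (a b : H →L[ℂ] H) : H →L[ℂ] H := (2⁻¹ : ℂ) • (a * b + b * a)

/-- A unital operator algebra on `H`: a norm closed subalgebra of `B(H)` with a contractive
identity element `e`. It is not required that `e` be the identity operator of `H`. If the algebra
is nonzero then `‖e‖ = 1`; the zero algebra is allowed. -/
structure IsUnitalOperatorAlgebra (M : Submodule ℂ (H →L[ℂ] H)) : Prop where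
  isClosed : IsClosed (M : Set (H →L[ℂ] H))
  mul_mem : ∀ x ∈ M, ∀ y ∈ M, x * y ∈ M
  exists_unit : ∃ e ∈ M, ‖e‖ ≤ 1 ∧ ∀ x ∈ M, e * x = x ∧ x * e = x

/-- A unital Jordan operator algebra on `H`: a norm closed subspace of `B(H)` closed under the
Jordan product, with a contractive identity element for that product. -/
structure IsUnitalJordanOperatorAlgebra (M : Submodule ℂ (H →L[ℂ] H)) : Prop where
  isClosed : IsClosed (M : Set (H →L[ℂ] H))
  jordanMul_mem : ∀ x ∈ M, ∀ y ∈ M, jordanMul x y ∈ M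
  exists_unit : ∃ e ∈ M, ‖e‖ ≤ 1 ∧ ∀ x ∈ M, jordanMul e x = x

/-- The subspace `F` of `B(H)`, with its operator space structure and weak* topology inherited
from `B(H)`, is a unital dual operator algebra with the product `m`: it is weak* closed, and
some completely isometric weak* homeomorphism carries it and `m` onto a weak* closed unital
operator algebra on some Hilbert space with the operator product. -/
def IsUnitalDualOperatorAlgebraWith (F : Submodule ℂ (H →L[ℂ] H)) (m : F → F → F) : Prop :=
  IsWeakStarClosed F ∧
  ∃ (K : Type u) (_ : NormedAddCommGroup K) (_ : InnerProductSpace ℂ K) (_ : CompleteSpace K)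
    (N : Submodule ℂ (K →L[ℂ] K)) (π : F ≃ₗ[ℂ] N),
    IsUnitalOperatorAlgebra N ∧ IsWeakStarClosed N ∧
    IsCompletelyIsometric π.toLinearMap ∧
    IsWeakStarContinuous π.toLinearMap ∧ IsWeakStarContinuous π.symm.toLinearMap ∧
    ∀ x y : F, (π (m x y) : K →L[ℂ] K) = (π x : K →L[ℂ] K) * (π y : K →L[ℂ] K)

/-- The subspace `F` of `B(H)`, with its operator space structure inherited from `B(H)`, is a
unital Jordan operator algebra with the product `m`: it is completely isometrically Jordan
isomorphic to a unital Jordan operator algebra on some Hilbert space. -/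
def IsUnitalJordanOperatorAlgebraWith (F : Submodule ℂ (H →L[ℂ] H)) (m : F → F → F) : Prop :=
  ∃ (K : Type u) (_ : NormedAddCommGroup K) (_ : InnerProductSpace ℂ K) (_ : CompleteSpace K)
    (N : Submodule ℂ (K →L[ℂ] K)) (π : F ≃ₗ[ℂ] N),
    IsUnitalJordanOperatorAlgebra N ∧ IsCompletelyIsometric π.toLinearMap ∧
    ∀ x y : F, (π (m x y) : K →L[ℂ] K) = jordanMul (π x : K →L[ℂ] K) (π y : K →L[ℂ] K)

variable {M : Submodule ℂ (H →L[ℂ] H)}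

/-- The fixed point space `M^Φ`, as a subspace of `B(H)`. -/
def fixedSpace (Φ : M →ₗ[ℂ] M) : Submodule ℂ (H →L[ℂ] H) :=
  (LinearMap.eqLocus Φ LinearMap.id).map M.subtype

/-- The range `P(M)`, as a subspace of `B(H)`. -/
def rangeSpace (P : M →ₗ[ℂ] M) : Submodule ℂ (H →L[ℂ] H) :=
  LinearMap.range (M.subtype ∘ₗ P)

theorem rangeSpace_le (P : M →ₗ[ℂ] M) : rangeSpace P ≤ M := by
  rintro _ ⟨x, rfl⟩
  exact (P x).2

/-- The new product `(x, y) ↦ P(xy)` on `P(M)`. -/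
def newMul (hM : IsUnitalOperatorAlgebra M) (P : M →ₗ[ℂ] M) (x y : rangeSpace P) :
    rangeSpace P :=
  ⟨P ⟨(x : H →L[ℂ] H) * (y : H →L[ℂ] H),
      hM.mul_mem _ (rangeSpace_le P x.2) _ (rangeSpace_le P y.2)⟩, ⟨_, rfl⟩⟩

/-- The new Jordan product `(x, y) ↦ P(x ∘ y)` on `P(M)`. -/
def newJordanMul (hM : IsUnitalJordanOperatorAlgebra M) (P : M →ₗ[ℂ] M) (x y : rangeSpace P) :
    rangeSpace P :=
  ⟨P ⟨jordanMul (x : H →L[ℂ] H) (y : H →L[ℂ] H),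
      hM.jordanMul_mem _ (rangeSpace_le P x.2) _ (rangeSpace_le P y.2)⟩, ⟨_, rfl⟩⟩

end Algebras

end

end OperatorAlg

/-! The projection is a mean ergodic one. The Cesàro means of `Φ` are again completely contractive
and real completely positive, and their pointwise weak limit `P` along an ultrafilter inherits both
properties. Weak* continuity of `Φ` and the telescoping identity `smul_map_cesaro_sub` give `Φ P =
P`, so `P` is idempotent with range `M^Φ`, which is weak* closed. Nothing makes `P` itself weak*
continuous, so normality of `P` is never used afterwards.

The new product is understood by leaving `M`. The identity `e` of `M` is a contractive idempotent,
hence a projection, and in the Jordan case it is also a two-sided identity for the operator product.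
An Arveson argument (`exists_isRCP_extension`) extends `P` to a real completely positive map on
`B(H)` that sends `1` to `P e`. Because `P` is idempotent, such extensions are closed under
composition; they form a compact semigroup for the point-weak topology in which one-sided
multiplication is continuous, so the Ellis–Numakura lemma supplies an idempotent extension `Q`. For
`Q` the Choi–Effros identity `Q(a Q(b)) = Q(ab)`, with `a` in the range, makes `(x, y) ↦ Q(xy)`
associative on the range of `Q`. A Stinespring construction on the kernel `Q(Q(b)* Q(c))` then
represents the range of `Q` multiplicatively and completely contractively by some `σ` with `V* σ(x)
V = x` for a contraction `V`; the compression forces `σ` to be completely isometric. This settles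
the Jordan case, since `Q(xy + yx) = 2 P(x ∘ y)` on `M^Φ` even when `xy` is not in `M`.

In the associative case the representation must also be a weak* homeomorphism, and `σ` need not be.
Here `IsRCP.map_eq_of_wTendsto`, a form of the Choi–Effros identity that survives weak limits, shows
that the product on `M^Φ` is separately weak* continuous on bounded sets although `Q` need not be
normal. Compressing `σ` to the semi-invariant subspace generated by the range of `V` keeps it
multiplicative and completely isometric, and leaves only matrix coefficients determined by `⟪η, (b x
a) ξ⟫`, products being taken in `M^Φ`; these are continuous in `x` on bounded sets. The
Krein–Šmulian theorem turns continuity on bounded sets into a weak* homeomorphism with weak* closed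
image. -/

namespace OperatorAlg

noncomputable section

open scoped InnerProductSpace Topology ComplexConjugate
open Filter

universe u

set_option linter.unusedSectionVars false

/-! ### Weak operator limits of bounded families, and their relation to the weak* topology. -/

section WeakLimits

variable {H : Type u} [NormedAddCommGroup H] [InnerProductSpace ℂ H] [CompleteSpace H]

/-- A bounded sesquilinear form is given by an operator. -/
theorem exists_clm_of_sesquilinear (G : H → H → ℂ) {C : ℝ} (hC : 0 ≤ C)
    (add_left : ∀ η η' ξ, G (η + η') ξ = G η ξ + G η' ξ)
    (smul_left : ∀ (c : ℂ) η ξ, G (c • η) ξ = conj c * G η ξ)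
    (add_right : ∀ η ξ ξ', G η (ξ + ξ') = G η ξ + G η ξ')
    (smul_right : ∀ (c : ℂ) η ξ, G η (c • ξ) = c * G η ξ)
    (bound : ∀ η ξ, ‖G η ξ‖ ≤ C * ‖η‖ * ‖ξ‖) :
    ∃ T : H →L[ℂ] H, ‖T‖ ≤ C ∧ ∀ η ξ, ⟪η, T ξ⟫_ℂ = G η ξ := by
  -- The conjugate makes the form linear in `η`, so that its Fréchet–Riesz vector can serve as `T
  -- ξ`.
  let ℓ : H → (H →L[ℂ] ℂ) := fun ξ => LinearMap.mkContinuous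
    { toFun := fun η => conj (G η ξ)
      map_add' := fun η η' => by simp [add_left]
      map_smul' := fun c η => by simp [smul_left] } (C * ‖ξ‖) (fun η => by
        simpa [mul_right_comm] using bound η ξ)
  have hℓ : ∀ ξ η, ⟪η, (InnerProductSpace.toDual ℂ H).symm (ℓ ξ)⟫_ℂ = G η ξ := fun ξ η => by
    rw [← inner_conj_symm, InnerProductSpace.toDual_symm_apply]
    simp [ℓ]
  let T₀ : H →ₗ[ℂ] H :=
    { toFun := fun ξ => (InnerProductSpace.toDual ℂ H).symm (ℓ ξ)
      map_add' := fun ξ ξ' => ext_inner_left ℂ fun η => by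
        rw [inner_add_right, hℓ, hℓ, hℓ, add_right]
      map_smul' := fun c ξ => ext_inner_left ℂ fun η => by
        rw [RingHom.id_apply, inner_smul_right, hℓ, hℓ, smul_right] }
  refine ⟨T₀.mkContinuous C fun ξ => ?_, LinearMap.mkContinuous_norm_le _ hC _, fun η ξ => hℓ ξ η⟩
  change ‖(InnerProductSpace.toDual ℂ H).symm (ℓ ξ)‖ ≤ _
  rw [LinearIsometryEquiv.norm_map]
  exact LinearMap.mkContinuous_norm_le _ (by positivity) _

/-- Convergence of operators in the weak operator topology. -/
def WTendsto {α : Type*} (T : α → H →L[ℂ] H) (l : Filter α) (T₀ : H →L[ℂ] H) : Prop :=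
  ∀ η ξ : H, Tendsto (fun a => ⟪η, T a ξ⟫_ℂ) l (𝓝 ⟪η, T₀ ξ⟫_ℂ)

theorem WTendsto.unique {α : Type*} {T : α → H →L[ℂ] H} {l : Filter α} [l.NeBot]
    {T₀ T₁ : H →L[ℂ] H} (h₀ : WTendsto T l T₀) (h₁ : WTendsto T l T₁) : T₀ = T₁ := by
  ext ξ
  exact ext_inner_left ℂ fun η => tendsto_nhds_unique (h₀ η ξ) (h₁ η ξ)

theorem WTendsto.add {α : Type*} {S T : α → H →L[ℂ] H} {l : Filter α}
    {S₀ T₀ : H →L[ℂ] H} (hS : WTendsto S l S₀) (hT : WTendsto T l T₀) :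
    WTendsto (fun a => S a + T a) l (S₀ + T₀) := fun η ξ => by
  simpa [inner_add_right] using (hS η ξ).add (hT η ξ)

theorem WTendsto.sub {α : Type*} {S T : α → H →L[ℂ] H} {l : Filter α}
    {S₀ T₀ : H →L[ℂ] H} (hS : WTendsto S l S₀) (hT : WTendsto T l T₀) :
    WTendsto (fun a => S a - T a) l (S₀ - T₀) := fun η ξ => by
  simpa [inner_sub_right] using (hS η ξ).sub (hT η ξ)

theorem WTendsto.const_smul {α : Type*} {S : α → H →L[ℂ] H} {l : Filter α}
    {S₀ : H →L[ℂ] H} (hS : WTendsto S l S₀) (c : ℂ) :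
    WTendsto (fun a => c • S a) l (c • S₀) := fun η ξ => by
  simpa [inner_smul_right] using (hS η ξ).const_mul c

theorem WTendsto.adjoint {α : Type*} {S : α → H →L[ℂ] H} {l : Filter α}
    {S₀ : H →L[ℂ] H} (hS : WTendsto S l S₀) :
    WTendsto (fun a => star (S a)) l (star S₀) := fun η ξ => by
  have := (Complex.continuous_conj.tendsto _).comp (hS ξ η)
  simpa [ContinuousLinearMap.star_eq_adjoint, ContinuousLinearMap.adjoint_inner_right,
    Function.comp_def] using this

theorem wTendsto_const {α : Type*} (S : H →L[ℂ] H) (l : Filter α) :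
    WTendsto (fun _ => S) l S := fun _ _ => tendsto_const_nhds

/-- Bounded families of operators converge weakly along ultrafilters. -/
theorem exists_wTendsto {α : Type*} (𝒰 : Ultrafilter α) (T : α → H →L[ℂ] H) {C : ℝ}
    (hT : ∀ᶠ a in (𝒰 : Filter α), ‖T a‖ ≤ C) :
    ∃ T₀ : H →L[ℂ] H, ‖T₀‖ ≤ C ∧ WTendsto T 𝒰 T₀ := by
  have hC : 0 ≤ C := by
    obtain ⟨a, ha⟩ := hT.exists
    exact (norm_nonneg _).trans ha
  have key : ∀ η ξ : H, ∃ z : ℂ, ‖z‖ ≤ C * ‖η‖ * ‖ξ‖ ∧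
      Tendsto (fun a => ⟪η, T a ξ⟫_ℂ) 𝒰 (𝓝 z) := fun η ξ => by
    obtain ⟨z, hz, hz'⟩ := (isCompact_closedBall (0 : ℂ) (C * ‖η‖ * ‖ξ‖)).ultrafilter_le_nhds
      (𝒰.map fun a => ⟪η, T a ξ⟫_ℂ) (by
        rw [le_principal_iff]
        change ∀ᶠ a in (𝒰 : Filter α), ⟪η, T a ξ⟫_ℂ ∈ Metric.closedBall (0 : ℂ) (C * ‖η‖ * ‖ξ‖)
        filter_upwards [hT] with a ha
        rw [mem_closedBall_zero_iff]
        calc ‖⟪η, T a ξ⟫_ℂ‖ ≤ ‖η‖ * ‖T a ξ‖ := norm_inner_le_norm _ _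
          _ ≤ ‖η‖ * (C * ‖ξ‖) := by
            gcongr
            exact (T a).le_of_opNorm_le ha ξ
          _ = _ := by ring)
    exact ⟨z, by simpa using hz, hz'⟩
  choose G hG hGt using key
  obtain ⟨T₀, hT₀, h⟩ := exists_clm_of_sesquilinear G hC
    (fun η η' ξ => tendsto_nhds_unique (hGt _ _) (by
      simpa [inner_add_left] using (hGt η ξ).add (hGt η' ξ)))
    (fun c η ξ => tendsto_nhds_unique (hGt _ _) (by
      simpa [inner_smul_left, mul_comm] using (hGt η ξ).const_mul (conj c)))
    (fun η ξ ξ' => tendsto_nhds_unique (hGt _ _) (by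
      simpa [inner_add_right] using (hGt η ξ).add (hGt η ξ')))
    (fun c η ξ => tendsto_nhds_unique (hGt _ _) (by
      simpa [inner_smul_right] using (hGt η ξ).const_mul c)) hG
  exact ⟨T₀, hT₀, fun η ξ => by rw [h]; exact hGt η ξ⟩

theorem norm_inner_apply_le (T : H →L[ℂ] H) {C : ℝ} (hT : ‖T‖ ≤ C) (η ξ : H) :
    ‖⟪η, T ξ⟫_ℂ‖ ≤ C * (‖η‖ * ‖ξ‖) := by
  calc ‖⟪η, T ξ⟫_ℂ‖ ≤ ‖η‖ * ‖T ξ‖ := norm_inner_le_norm _ _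
    _ ≤ ‖η‖ * (C * ‖ξ‖) := by
      gcongr
      exact T.le_of_opNorm_le hT ξ
    _ = _ := by ring

theorem summable_norm_mul_norm (p : lp (fun _ : ℕ => H) 2 × lp (fun _ : ℕ => H) 2) :
    Summable fun n => ‖p.2 n‖ * ‖p.1 n‖ := by
  have h1 := (lp.memℓp p.1).summable (by norm_num)
  have h2 := (lp.memℓp p.2).summable (by norm_num)
  refine Summable.of_nonneg_of_le (fun n => by positivity) (fun n => ?_) (h1.add h2)
  have e1 : ‖p.1 n‖ ^ (2 : ENNReal).toReal = ‖p.1 n‖ ^ 2 := by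
    rw [ENNReal.toReal_ofNat, Real.rpow_ofNat]
  have e2 : ‖p.2 n‖ ^ (2 : ENNReal).toReal = ‖p.2 n‖ ^ 2 := by
    rw [ENNReal.toReal_ofNat, Real.rpow_ofNat]
  rw [e1, e2]
  nlinarith [sq_nonneg (‖p.1 n‖ - ‖p.2 n‖), sq_nonneg (‖p.1 n‖), sq_nonneg ‖p.2 n‖]

theorem summable_inner_apply (T : H →L[ℂ] H)
    (p : lp (fun _ : ℕ => H) 2 × lp (fun _ : ℕ => H) 2) :
    Summable fun n => ⟪p.2 n, T (p.1 n)⟫_ℂ :=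
  .of_norm_bounded ((summable_norm_mul_norm p).mul_left ‖T‖)
    fun _ => norm_inner_apply_le T le_rfl _ _

theorem tendsto_weakStar_iff {α : Type*} {T : α → H →L[ℂ] H} {l : Filter α}
    {T₀ : H →L[ℂ] H} : Tendsto T l (@nhds _ (weakStar H) T₀) ↔
      ∀ p : lp (fun _ : ℕ => H) 2 × lp (fun _ : ℕ => H) 2,
        Tendsto (fun a => ∑' n, ⟪p.2 n, T a (p.1 n)⟫_ℂ) l (𝓝 (∑' n, ⟪p.2 n, T₀ (p.1 n)⟫_ℂ)) := by
  rw [nhds_induced, tendsto_comap_iff, tendsto_pi_nhds]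
  rfl

/-- On bounded sets weak operator convergence implies weak* convergence. -/
theorem WTendsto.tendsto_weakStar {α : Type*} {T : α → H →L[ℂ] H} {l : Filter α}
    {T₀ : H →L[ℂ] H} (h : WTendsto T l T₀) {C : ℝ} (hC : ∀ᶠ a in l, ‖T a‖ ≤ C) :
    Tendsto T l (@nhds _ (weakStar H) T₀) := by
  rw [tendsto_weakStar_iff]
  intro p
  refine tendsto_tsum_of_dominated_convergence ((summable_norm_mul_norm p).mul_left C)
    (fun n => h _ _) ?_
  filter_upwards [hC] with a ha n using norm_inner_apply_le _ ha _ _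

theorem wTendsto_of_tendsto_weakStar {α : Type*} {T : α → H →L[ℂ] H} {l : Filter α}
    {T₀ : H →L[ℂ] H} (h : Tendsto T l (@nhds _ (weakStar H) T₀)) : WTendsto T l T₀ := by
  intro η ξ
  -- Sequences supported at index `0` reduce the weak* functional to a single vector functional.
  have := tendsto_weakStar_iff.1 h (lp.single 2 0 ξ, lp.single 2 0 η)
  have e : ∀ S : H →L[ℂ] H, ∑' n, ⟪(lp.single (E := fun _ : ℕ => H) 2 0 η) n,
      S ((lp.single (E := fun _ : ℕ => H) 2 0 ξ) n)⟫_ℂ = ⟪η, S ξ⟫_ℂ := fun S => by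
    rw [tsum_eq_single 0]
    · simp
    · intro n hn
      simp [hn]
  simpa only [e] using this

theorem IsWeakStarClosed.mem_of_wTendsto {S : Submodule ℂ (H →L[ℂ] H)} (hS : IsWeakStarClosed S)
    {α : Type*} {T : α → H →L[ℂ] H} {l : Filter α} [l.NeBot] {T₀ : H →L[ℂ] H}
    (h : WTendsto T l T₀) {C : ℝ} (hC : ∀ᶠ a in l, ‖T a‖ ≤ C) (hT : ∀ᶠ a in l, T a ∈ S) :
    T₀ ∈ S := by
  let _ := weakStar H
  exact IsClosed.mem_of_tendsto hS (h.tendsto_weakStar hC) hT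

theorem opNorm_le_of_norm_inner_le {T : H →L[ℂ] H} {C : ℝ} (hC : 0 ≤ C)
    (h : ∀ η ξ : H, ‖⟪η, T ξ⟫_ℂ‖ ≤ C * (‖η‖ * ‖ξ‖)) : ‖T‖ ≤ C := by
  refine T.opNorm_le_bound hC fun ξ => ?_
  have h1 := h (T ξ) ξ
  rw [inner_self_eq_norm_sq_to_K] at h1
  simp only [Complex.coe_algebraMap, norm_pow, Complex.norm_real, norm_norm] at h1
  rcases (norm_nonneg (T ξ)).eq_or_lt with h0 | h0
  · rw [← h0]
    positivity
  · nlinarith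

theorem WTendsto.norm_le {α : Type*} {T : α → H →L[ℂ] H} {l : Filter α} [l.NeBot]
    {T₀ : H →L[ℂ] H} (h : WTendsto T l T₀) {C : ℝ} (hC : ∀ᶠ a in l, ‖T a‖ ≤ C) : ‖T₀‖ ≤ C := by
  have h0 : 0 ≤ C := by
    obtain ⟨a, ha⟩ := hC.exists
    exact (norm_nonneg _).trans ha
  refine opNorm_le_of_norm_inner_le h0 fun η ξ => le_of_tendsto (h η ξ).norm ?_
  filter_upwards [hC] with a ha using norm_inner_apply_le _ ha _ _

end WeakLimits

/-! ### Accretivity and norms of operator matrices in terms of vectors. -/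

section Matrices

variable {H : Type u} [NormedAddCommGroup H] [InnerProductSpace ℂ H] [CompleteSpace H]

/-- A matrix of operators with accretive quadratic form. -/
def RPMat {ι : Type*} [Fintype ι] (a : ι → ι → H →L[ℂ] H) : Prop :=
  ∀ v : ι → H, 0 ≤ (∑ i, ∑ j, ⟪v i, a i j (v j)⟫_ℂ).re

theorem isRealPositive_iff {E : Type u} [NormedAddCommGroup E] [InnerProductSpace ℂ E]
    [CompleteSpace E] (T : E →L[ℂ] E) : IsRealPositive T ↔ ∀ v, 0 ≤ (⟪v, T v⟫_ℂ).re := by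
  have key : ∀ v, (T + ContinuousLinearMap.adjoint T).reApplyInnerSelf v
      = 2 * (⟪v, T v⟫_ℂ).re := fun v => by
    rw [ContinuousLinearMap.reApplyInnerSelf_apply, add_apply, inner_add_left,
      ContinuousLinearMap.adjoint_inner_left]
    have : (⟪T v, v⟫_ℂ).re = (⟪v, T v⟫_ℂ).re := by rw [← inner_conj_symm, Complex.conj_re]
    simp only [map_add, RCLike.re_to_complex, this]
    ring
  rw [IsRealPositive, ContinuousLinearMap.isPositive_def']
  constructor
  · rintro ⟨-, h⟩ v
    have := h v
    rw [key] at this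
    linarith
  · intro h
    refine ⟨?_, fun v => ?_⟩
    · rw [← ContinuousLinearMap.star_eq_adjoint]
      exact IsSelfAdjoint.add_star_self T
    · rw [key]
      have := h v
      linarith

theorem isRealPositive_subMatOp_iff {S : Submodule ℂ (H →L[ℂ] H)} {n : ℕ}
    (a : Matrix (Fin n) (Fin n) S) :
    IsRealPositive (subMatOp S a) ↔ RPMat fun i j => (a i j : H →L[ℂ] H) := by
  rw [isRealPositive_iff]
  have key : ∀ v : PiLp 2 (fun _ : Fin n => H), ⟪v, subMatOp S a v⟫_ℂ
      = ∑ i, ∑ j, ⟪v i, (a i j : H →L[ℂ] H) (v j)⟫_ℂ := fun v => by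
    rw [PiLp.inner_apply]
    refine Finset.sum_congr rfl fun i _ => ?_
    rw [subMatOp, matOp_apply, inner_sum]
    rfl
  constructor
  · intro h v
    have := h (WithLp.toLp 2 v)
    rwa [key] at this
  · intro h v
    rw [key]
    exact h v

theorem RPMat.reindex {ι κ : Type*} [Fintype ι] [Fintype κ] {a : ι → ι → H →L[ℂ] H}
    (h : RPMat a) (e : κ ≃ ι) : RPMat fun i j => a (e i) (e j) := by
  intro v
  have := h (v ∘ e.symm)
  rw [← e.sum_comp] at this
  convert this using 4 with i
  rw [← e.sum_comp]
  simp

/-- Real complete positivity for matrices indexed by arbitrary finite types. -/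
theorem IsRealCompletelyPositive.rpMat {S : Submodule ℂ (H →L[ℂ] H)} {T : S →ₗ[ℂ] S}
    (hT : IsRealCompletelyPositive T) {ι : Type*} [Fintype ι] (a : ι → ι → S)
    (ha : RPMat fun i j => (a i j : H →L[ℂ] H)) :
    RPMat fun i j => (T (a i j) : H →L[ℂ] H) := by
  let e := Fintype.equivFin ι
  have h := hT _ (Matrix.of fun i j => a (e.symm i) (e.symm j))
    ((isRealPositive_subMatOp_iff _).2 (ha.reindex e.symm))
  rw [isRealPositive_subMatOp_iff] at h
  simpa using h.reindex e

theorem norm_matOp_le_iff {n : ℕ} (a : Matrix (Fin n) (Fin n) (H →L[ℂ] H)) {C : ℝ} (hC : 0 ≤ C) :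
    ‖matOp a‖ ≤ C ↔ ∀ v : Fin n → H, ∑ i, ‖∑ j, a i j (v j)‖ ^ 2 ≤ C ^ 2 * ∑ j, ‖v j‖ ^ 2 := by
  rw [ContinuousLinearMap.opNorm_le_iff hC]
  have key : ∀ v : PiLp 2 (fun _ : Fin n => H), ‖matOp a v‖ ≤ C * ‖v‖ ↔
      ∑ i, ‖∑ j, a i j (v j)‖ ^ 2 ≤ C ^ 2 * ∑ j, ‖v j‖ ^ 2 := fun v => by
    rw [← sq_le_sq₀ (norm_nonneg _) (by positivity), mul_pow, PiLp.norm_sq_eq_of_L2,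
      PiLp.norm_sq_eq_of_L2]
    simp only [matOp_apply]
  constructor
  · intro h v
    exact (key (WithLp.toLp 2 v)).1 (h _)
  · intro h v
    exact (key v).2 (h _)

end Matrices

/-! ### Arveson extension through the Riesz extension theorem. -/

section Extension

variable {H : Type u} [NormedAddCommGroup H] [InnerProductSpace ℂ H] [CompleteSpace H]

/-- Real complete positivity of a linear map on all of `B(H)`. -/
def IsRCP (Ψ : (H →L[ℂ] H) →ₗ[ℂ] (H →L[ℂ] H)) : Prop :=
  ∀ (n : ℕ) (a : Fin n → Fin n → H →L[ℂ] H), RPMat a → RPMat fun i j => Ψ (a i j)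

theorem IsRCP.rpMat {Ψ : (H →L[ℂ] H) →ₗ[ℂ] (H →L[ℂ] H)} (hΨ : IsRCP Ψ) {ι : Type*} [Fintype ι]
    {a : ι → ι → H →L[ℂ] H} (ha : RPMat a) : RPMat fun i j => Ψ (a i j) := by
  let e := Fintype.equivFin ι
  simpa using (hΨ _ _ (ha.reindex e.symm)).reindex e

/-- The vector functional `b ↦ ⟪η, b ξ⟫`. -/
def vecFunctional (η ξ : H) : (H →L[ℂ] H) →ₗ[ℂ] ℂ where
  toFun b := ⟪η, b ξ⟫_ℂ
  map_add' b b' := by simp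
  map_smul' c b := by simp

@[simp]
theorem vecFunctional_apply (η ξ : H) (b : H →L[ℂ] H) : vecFunctional η ξ b = ⟪η, b ξ⟫_ℂ := rfl

/-- The value of a finitely supported operator matrix, indexed by `H`, at the vectors `e (v ·)`. -/
def quadForm (e : H →L[ℂ] H) (v : H → H) : (H × H →₀ (H →L[ℂ] H)) →ₗ[ℂ] ℂ :=
  Finsupp.lsum ℂ fun p => vecFunctional (e (v p.1)) (e (v p.2))

@[simp]
theorem quadForm_single (e : H →L[ℂ] H) (v : H → H) (η ξ : H) (b : H →L[ℂ] H) :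
    quadForm e v (Finsupp.single (η, ξ) b) = ⟪e (v η), b (e (v ξ))⟫_ℂ := by
  simp [quadForm]

/-- The finitely supported operator matrices that are accretive after compression by `e`. -/
def accretiveCone (e : H →L[ℂ] H) : PointedCone ℝ (H × H →₀ (H →L[ℂ] H)) where
  carrier := {c | ∀ v, 0 ≤ (quadForm e v c).re}
  add_mem' h h' v := by simpa using add_nonneg (h v) (h' v)
  zero_mem' v := by simp
  smul_mem' r c h v := by
    have : (quadForm e v (r • c)) = ((r : ℝ) : ℂ) * quadForm e v c := by
      have : r • c = ((r : ℝ) : ℂ) • c := by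
        ext; simp
      rw [this, map_smul, smul_eq_mul]
    rw [this, Complex.re_ofReal_mul]
    exact mul_nonneg r.2 (h v)

/-- Diagonal dominance: the form of an entry `b` at `(η, ξ)` is at most `‖b‖ ‖e v η‖ ‖e v ξ‖`, which
is absorbed by `‖b‖ e` placed at both diagonal positions. This is the cofinality hypothesis of
`riesz_extension`. -/
theorem exists_add_mem_accretiveCone {M : Submodule ℂ (H →L[ℂ] H)} {e : H →L[ℂ] H} (he : e ∈ M)
    (hee : e * e = e) (y : H × H →₀ (H →L[ℂ] H)) :
    ∃ x : H × H →₀ (H →L[ℂ] H), (∀ p, x p ∈ M) ∧ x + y ∈ accretiveCone e := by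
  induction y using Finsupp.induction_linear with
  | zero => exact ⟨0, fun p => by simp, by simp⟩
  | add y y' h h' =>
    obtain ⟨x, hx, hxy⟩ := h
    obtain ⟨x', hx', hxy'⟩ := h'
    refine ⟨x + x', fun p => M.add_mem (hx p) (hx' p), ?_⟩
    have := add_mem hxy hxy'
    rwa [add_add_add_comm] at this
  | single p b =>
    obtain ⟨η, ξ⟩ := p
    refine ⟨Finsupp.single (η, η) ((‖b‖ : ℂ) • e) + Finsupp.single (ξ, ξ) ((‖b‖ : ℂ) • e),
      fun p => ?_, fun v => ?_⟩
    · classical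
      rw [Finsupp.add_apply, Finsupp.single_apply, Finsupp.single_apply]
      refine M.add_mem ?_ ?_ <;> split_ifs <;> first | exact M.smul_mem _ he | exact M.zero_mem
    · have h1 : ∀ w : H, ⟪e w, e (e w)⟫_ℂ = ((‖e w‖ ^ 2 : ℝ) : ℂ) := fun w => by
        have : e (e w) = e w := congrArg (fun T : H →L[ℂ] H => T w) hee
        rw [this, inner_self_eq_norm_sq_to_K]
        simp
      simp only [map_add, quadForm_single, smul_apply, inner_smul_right, h1, Complex.add_re]
      rw [Complex.re_ofReal_mul, Complex.re_ofReal_mul, Complex.ofReal_re, Complex.ofReal_re]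
      have h2 := (Complex.abs_re_le_norm _).trans
        (norm_inner_apply_le b le_rfl (e (v η)) (e (v ξ)))
      have h3 := neg_abs_le (⟪e (v η), b (e (v ξ))⟫_ℂ).re
      nlinarith [norm_nonneg b, mul_nonneg (norm_nonneg b) (sq_nonneg (‖e (v η)‖ - ‖e (v ξ)‖)),
        mul_nonneg (norm_nonneg b) (sq_nonneg (‖e (v η)‖)),
        mul_nonneg (norm_nonneg b) (sq_nonneg (‖e (v ξ)‖))]

/-- The values of a real completely positive map on accretive finitely supported matrices. -/
theorem nonneg_of_mem_accretiveCone {M : Submodule ℂ (H →L[ℂ] H)} {P : M →ₗ[ℂ] M}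
    (hP : IsRealCompletelyPositive P) {e : H →L[ℂ] H} (hes : star e = e)
    (hunit : ∀ x ∈ M, e * x = x ∧ x * e = x)
    (P' : (H →L[ℂ] H) →ₗ[ℂ] (H →L[ℂ] H)) (hPval : ∀ x : M, P' x = P x)
    (c : H × H →₀ (H →L[ℂ] H)) (hcM : ∀ p, c p ∈ M) (hc : c ∈ accretiveCone e) :
    0 ≤ (Finsupp.lsum ℂ (fun p => (vecFunctional p.1 p.2).comp P') c).re := by
  classical
  -- Row and column labels are pooled so that `c` becomes a square matrix, to which real complete
  -- positivity applies.
  let s : Finset H := c.support.image Prod.fst ∪ c.support.image Prod.snd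
  have hs : c.support ⊆ s ×ˢ s := fun p hp => by
    simp only [s, Finset.mem_product, Finset.mem_union, Finset.mem_image]
    exact ⟨Or.inl ⟨p, hp, rfl⟩, Or.inr ⟨p, hp, rfl⟩⟩
  have key : ∀ h : H × H → (H →L[ℂ] H) →ₗ[ℂ] ℂ, Finsupp.lsum ℂ h c
      = ∑ i : s, ∑ j : s, h (i, j) (c (i, j)) := fun h => by
    rw [Finsupp.lsum_apply, Finsupp.sum_of_support_subset c hs _ (fun _ _ => map_zero _),
      Finset.sum_product, ← Finset.sum_coe_sort s]
    refine Finset.sum_congr rfl fun i _ => ?_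
    rw [← Finset.sum_coe_sort s]
  have h1 := hP.rpMat (fun i j : s => (⟨c (i, j), hcM _⟩ : M)) (fun w => by
    let v : H → H := fun x => if h : x ∈ s then w ⟨x, h⟩ else 0
    have hv : ∀ i : s, v i = w i := fun i => by simp [v]
    have := hc v
    rw [quadForm, key] at this
    convert this using 6 with i _ j _
    obtain ⟨ha, hb⟩ := hunit _ (hcM (i, j))
    rw [vecFunctional_apply, hv, hv]
    have e1 : c (i, j) (e (w j)) = c (i, j) (w j) := congrArg (fun T : H →L[ℂ] H => T (w j)) hb
    have e2 : e (c (i, j) (w j)) = c (i, j) (w j) := congrArg (fun T : H →L[ℂ] H => T (w j)) ha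
    rw [e1, ← ContinuousLinearMap.adjoint_inner_right, ← ContinuousLinearMap.star_eq_adjoint, hes,
      e2]) (fun i => i)
  rw [key]
  convert h1 using 6 with i _ j _
  simp [← hPval]

/-- **Arveson extension**: a real completely positive map on a unital subspace of `B(H)` extends
to a real completely positive map on `B(H)`. -/
theorem exists_isRCP_extension {M : Submodule ℂ (H →L[ℂ] H)} {P : M →ₗ[ℂ] M}
    (hP : IsRealCompletelyPositive P) {e : H →L[ℂ] H} (he : e ∈ M) (hes : star e = e)
    (hunit : ∀ x ∈ M, e * x = x ∧ x * e = x) (hPe : ‖P ⟨e, he⟩‖ ≤ 1) :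
    ∃ Ψ : (H →L[ℂ] H) →ₗ[ℂ] (H →L[ℂ] H), IsRCP Ψ ∧ (∀ x : M, Ψ x = P x) ∧ Ψ 1 = P ⟨e, he⟩ := by
  have hee : e * e = e := (hunit e he).1
  have hee' : ∀ w, e (e w) = e w := fun w => congrArg (fun T : H →L[ℂ] H => T w) hee
  -- An arbitrary algebraic extension, used only to write `f₀` as a total map; `f₀` is restricted to
  -- matrices over `M` before it is extended positively.
  obtain ⟨P', hPval⟩ := (M.subtype.comp P).exists_extend
  have hPval : ∀ x : M, P' x = P x := fun x => congrArg (fun T : M →ₗ[ℂ] (H →L[ℂ] H) => T x) hPval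
  let D : Submodule ℝ (H × H →₀ (H →L[ℂ] H)) :=
    { carrier := {c | ∀ p, c p ∈ M}
      add_mem' := fun h h' p => M.add_mem (h p) (h' p)
      zero_mem' := fun p => M.zero_mem
      smul_mem' := fun r c h p => by
        have : (r • c) p = (r : ℂ) • c p := by simp
        rw [this]
        exact M.smul_mem _ (h p) }
  let f₀ : (H × H →₀ (H →L[ℂ] H)) →ₗ[ℝ] ℝ := Complex.reLm ∘ₗ
    (Finsupp.lsum ℂ (fun p : H × H => (vecFunctional p.1 p.2).comp P')).restrictScalars ℝ
  obtain ⟨g, hgf, hg⟩ := riesz_extension (accretiveCone e) (f₀.toPMap D)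
    (fun x hx => nonneg_of_mem_accretiveCone hP hes hunit P' hPval x x.2 hx)
    (fun y => by
      obtain ⟨x, hx, hxy⟩ := exists_add_mem_accretiveCone he hee y
      exact ⟨⟨x, hx⟩, hxy⟩)
  -- If the forms agree, the difference and its negative both lie in the cone. In particular `g`
  -- sees an entry `b` only through its compression `e b e`.
  have g_congr : ∀ c c', (∀ v, (quadForm e v c).re = (quadForm e v c').re) → g c = g c' := by
    intro c c' h
    refine le_antisymm ?_ ?_ <;> rw [← sub_nonneg, ← map_sub] <;> refine hg _ fun v => ?_ <;>
      simp [h v]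
  -- The vectors `η`, `ξ` are only labels here, so linearity of `r` in them has to be derived from
  -- positivity of `g`.
  let r : H → H → (H →L[ℂ] H) → ℝ := fun η ξ b => g (Finsupp.single (η, ξ) b)
  have r_def : ∀ η ξ b, g (Finsupp.single (η, ξ) b) = r η ξ b := fun _ _ _ => rfl
  have r_add : ∀ η ξ b b', r η ξ (b + b') = r η ξ b + r η ξ b' := fun η ξ b b' => by
    simp [r]
  have r_smul : ∀ η ξ (t : ℝ) b, r η ξ ((t : ℂ) • b) = t * r η ξ b := fun η ξ t b => by
    have : Finsupp.single (η, ξ) ((t : ℂ) • b) = t • Finsupp.single (η, ξ) b := by simp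
    change g _ = t * g _
    rw [this, map_smul, smul_eq_mul]
  have r_mem : ∀ η ξ (x : M), r η ξ x = (⟪η, (P x : H →L[ℂ] H) ξ⟫_ℂ).re := fun η ξ x => by
    have := hgf ⟨Finsupp.single (η, ξ) (x : H →L[ℂ] H), fun p => by
      classical
      rw [Finsupp.single_apply]
      split_ifs
      exacts [x.2, M.zero_mem]⟩
    rw [← hPval]
    simpa [f₀] using this
  have r_star : ∀ η ξ b, r η ξ b = r ξ η (star b) := fun η ξ b => g_congr _ _ fun v => by
    rw [quadForm_single, quadForm_single, ContinuousLinearMap.star_eq_adjoint,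
      ContinuousLinearMap.adjoint_inner_right, ← inner_conj_symm, Complex.conj_re]
  have r_one : ∀ η ξ (c : ℂ), r η ξ (c • 1) = (c * ⟪η, (P ⟨e, he⟩ : H →L[ℂ] H) ξ⟫_ℂ).re :=
      fun η ξ c => by
    have h1 : r η ξ (c • 1) = r η ξ (c • e) := g_congr _ _ fun v => by simp [hee']
    rw [h1]
    refine (r_mem η ξ (c • ⟨e, he⟩)).trans ?_
    rw [map_smul, Submodule.coe_smul, smul_apply, inner_smul_right]
  have P_le : ∀ ζ, (⟪ζ, (P ⟨e, he⟩ : H →L[ℂ] H) ζ⟫_ℂ).re ≤ ‖ζ‖ ^ 2 := fun ζ => by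
    have := (Complex.re_le_norm _).trans (norm_inner_apply_le (P ⟨e, he⟩ : H →L[ℂ] H) hPe ζ ζ)
    linarith
  -- the Cauchy–Schwarz inequality for the extended functional
  have key : ∀ {ι : Type} [Fintype ι] (η : H) (b : H →L[ℂ] H) (ξ : ι → H) (c : ι → ℂ),
      (∑ k, r η (ξ k) (c k • b)) ^ 2 ≤ (‖b‖ * ‖η‖) ^ 2 * ‖∑ k, c k • ξ k‖ ^ 2 := by
    intro ι _ η b ξ c
    set ζ := ∑ k, c k • ξ k with hζ
    set A := r η η (b * star b) with hA
    set L := ∑ k, r η (ξ k) (c k • b) with hL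
    have hZ : ∑ k, ∑ l, r (ξ k) (ξ l) ((conj (c k) * c l) • 1)
        = (⟪ζ, (P ⟨e, he⟩ : H →L[ℂ] H) ζ⟫_ℂ).re := by
      rw [hζ, map_sum, sum_inner, Complex.re_sum]
      refine Finset.sum_congr rfl fun k _ => ?_
      rw [inner_sum, Complex.re_sum]
      refine Finset.sum_congr rfl fun l _ => ?_
      rw [r_one, map_smul, inner_smul_left, inner_smul_right, mul_assoc]
    have hquad : ∀ t : ℝ, 0 ≤ A * (t * t) + (2 * L) * t +
        (⟪ζ, (P ⟨e, he⟩ : H →L[ℂ] H) ζ⟫_ℂ).re := fun t => by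
      -- This matrix is chosen so that its form at `v` is the perfect square of `t b* e v(η) + ∑ c_k
      -- e v(ξ_k)`. Applying `g` gives a real quadratic in `t`, whose discriminant yields the
      -- inequality.
      have hmem := hg (Finsupp.single (η, η) (((t * t : ℝ) : ℂ) • (b * star b)) +
        ∑ k, (Finsupp.single (η, ξ k) ((t : ℂ) • c k • b) +
          Finsupp.single (ξ k, η) ((t : ℂ) • star (c k • b))) +
        ∑ k, ∑ l, Finsupp.single (ξ k, ξ l) ((conj (c k) * c l) • 1)) (fun v => by
          have : quadForm e v (Finsupp.single (η, η) (((t * t : ℝ) : ℂ) • (b * star b)) +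
              ∑ k, (Finsupp.single (η, ξ k) ((t : ℂ) • c k • b) +
                Finsupp.single (ξ k, η) ((t : ℂ) • star (c k • b))) +
              ∑ k, ∑ l, Finsupp.single (ξ k, ξ l) ((conj (c k) * c l) • 1))
              = ⟪(t : ℂ) • (star b) (e (v η)) + ∑ k, c k • e (v (ξ k)),
                (t : ℂ) • (star b) (e (v η)) + ∑ k, c k • e (v (ξ k))⟫_ℂ := by
            have h1 : ⟪e (v η), (((t * t : ℝ) : ℂ) • (b * star b)) (e (v η))⟫_ℂ
                = ⟪(t : ℂ) • (star b) (e (v η)), (t : ℂ) • (star b) (e (v η))⟫_ℂ := by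
              simp only [inner_smul_left, inner_smul_right, smul_apply,
                ContinuousLinearMap.star_eq_adjoint, ContinuousLinearMap.adjoint_inner_left,
                mul_apply_eq_comp, Complex.conj_ofReal, Complex.ofReal_mul]
              ring
            have h2 : ∀ k, ⟪e (v η), ((t : ℂ) • c k • b) (e (v (ξ k)))⟫_ℂ
                = ⟪(t : ℂ) • (star b) (e (v η)), c k • e (v (ξ k))⟫_ℂ := fun k => by
              simp only [inner_smul_left, inner_smul_right, smul_apply, Complex.conj_ofReal,
                ContinuousLinearMap.star_eq_adjoint, ContinuousLinearMap.adjoint_inner_left]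
              ring
            have h3 : ∀ k, ⟪e (v (ξ k)), ((t : ℂ) • star (c k • b)) (e (v η))⟫_ℂ
                = ⟪c k • e (v (ξ k)), (t : ℂ) • (star b) (e (v η))⟫_ℂ := fun k => by
              rw [star_smul]
              simp only [inner_smul_left, inner_smul_right, smul_apply, RCLike.star_def]
            have h4 : ∀ k l, ⟪e (v (ξ k)),
                ((conj (c k) * c l) • (1 : H →L[ℂ] H)) (e (v (ξ l)))⟫_ℂ
                = ⟪c k • e (v (ξ k)), c l • e (v (ξ l))⟫_ℂ := fun k l => by
              simp only [inner_smul_left, inner_smul_right, smul_apply, one_apply_eq_self]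
              ring
            have h5 : ⟪∑ k, c k • e (v (ξ k)), ∑ k, c k • e (v (ξ k))⟫_ℂ
                = ∑ k, ∑ l, ⟪c k • e (v (ξ k)), c l • e (v (ξ l))⟫_ℂ := by
              rw [sum_inner]
              exact Finset.sum_congr rfl fun k _ => inner_sum _ _ _
            simp only [map_add, map_sum, quadForm_single, h1, h2, h3, h4, inner_add_left,
              inner_add_right, h5]
            rw [sum_inner, inner_sum, Finset.sum_add_distrib]
            ring
          rw [this]
          exact inner_self_nonneg (𝕜 := ℂ))
      simp only [map_add, map_sum, r_def, r_smul, hZ] at hmem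
      simp only [← r_star, Finset.sum_add_distrib, ← Finset.mul_sum] at hmem
      linarith
    have hdisc := discrim_le_zero hquad
    have hA' : A ≤ (‖b‖ * ‖η‖) ^ 2 := by
      have h1 := hg (Finsupp.single (η, η) (((‖b‖ ^ 2 : ℝ) : ℂ) • 1 - b * star b)) (fun v => by
        rw [quadForm_single]
        have : ‖(star b) (e (v η))‖ ≤ ‖b‖ * ‖e (v η)‖ :=
          (star b).le_of_opNorm_le (norm_star b).le _
        have h2 : ⟪e (v η), (b * star b) (e (v η))⟫_ℂ = ((‖(star b) (e (v η))‖ ^ 2 : ℝ) : ℂ) := by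
          rw [mul_apply_eq_comp, ← ContinuousLinearMap.adjoint_inner_left,
            ← ContinuousLinearMap.star_eq_adjoint, inner_self_eq_norm_sq_to_K]
          simp
        rw [sub_apply, inner_sub_right, h2, smul_apply, one_apply_eq_self, inner_smul_right]
        have h5 : ⟪e (v η), e (v η)⟫_ℂ = ((‖e (v η)‖ ^ 2 : ℝ) : ℂ) := by
          rw [inner_self_eq_norm_sq_to_K]
          simp
        have h3 := pow_le_pow_left₀ (norm_nonneg _) this 2
        rw [h5, ← Complex.ofReal_mul, ← Complex.ofReal_sub, Complex.ofReal_re]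
        linarith [mul_pow ‖b‖ ‖e (v η)‖ 2])
      have h4 : r η η (((‖b‖ ^ 2 : ℝ) : ℂ) • 1) ≤ ‖b‖ ^ 2 * ‖η‖ ^ 2 := by
        rw [r_one, Complex.re_ofReal_mul]
        exact mul_le_mul_of_nonneg_left (P_le η) (by positivity)
      rw [Finsupp.single_sub, map_sub, r_def, r_def] at h1
      rw [mul_pow]
      linarith
    have hZ0 : 0 ≤ (⟪ζ, (P ⟨e, he⟩ : H →L[ℂ] H) ζ⟫_ℂ).re := by
      simpa using hquad 0
    have h5 : A * (⟪ζ, (P ⟨e, he⟩ : H →L[ℂ] H) ζ⟫_ℂ).re ≤ (‖b‖ * ‖η‖) ^ 2 * ‖ζ‖ ^ 2 :=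
      (mul_le_mul_of_nonneg_right hA' hZ0).trans
        (mul_le_mul_of_nonneg_left (P_le ζ) (by positivity))
    rw [discrim] at hdisc
    linarith
  -- The labels `ξ + ξ'`, `ξ`, `ξ'` with coefficients `1, -1, -1` combine to the zero vector, so the
  -- right side of `key` vanishes. Homogeneity follows in the same way.
  have r_add_right : ∀ η ξ ξ' b, r η (ξ + ξ') b = r η ξ b + r η ξ' b := fun η ξ ξ' b => by
    have := key η b ![ξ + ξ', ξ, ξ'] ![1, -1, -1]
    have hs : (1 : ℂ) • (ξ + ξ') + (-1 : ℂ) • ξ + (-1 : ℂ) • ξ' = 0 := by module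
    simp only [Fin.sum_univ_three, Matrix.cons_val_zero, Matrix.cons_val_one, Matrix.cons_val, hs]
      at this
    have h1 : ∀ ζ, r η ζ ((-1 : ℂ) • b) = - r η ζ b := fun ζ => by
      simpa using r_smul η ζ (-1) b
    rw [h1, h1, one_smul, norm_zero] at this
    simp only [ne_eq, OfNat.ofNat_ne_zero, not_false_eq_true, zero_pow, mul_zero] at this
    have h0 := pow_eq_zero_iff (two_ne_zero) |>.1 (le_antisymm this (sq_nonneg _))
    linarith
  have r_smul_right : ∀ η ξ (c : ℂ) b, r η (c • ξ) b = r η ξ (c • b) := fun η ξ c b => by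
    have := key η b ![c • ξ, ξ] ![1, -c]
    have hs : (1 : ℂ) • c • ξ + (-c) • ξ = 0 := by module
    simp only [Fin.sum_univ_two, Matrix.cons_val_zero, Matrix.cons_val_one, hs] at this
    have h1 : r η ξ ((-c) • b) = - r η ξ (c • b) := by
      have := r_smul η ξ (-1) (c • b)
      rwa [smul_smul, Complex.ofReal_neg, Complex.ofReal_one, neg_one_mul, neg_one_mul] at this
    rw [h1, one_smul, norm_zero] at this
    simp only [ne_eq, OfNat.ofNat_ne_zero, not_false_eq_true, zero_pow, mul_zero] at this
    have h0 := pow_eq_zero_iff (two_ne_zero) |>.1 (le_antisymm this (sq_nonneg _))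
    linarith
  have r_add_left : ∀ η η' ξ b, r (η + η') ξ b = r η ξ b + r η' ξ b := fun η η' ξ b => by
    rw [r_star, r_add_right, ← r_star, ← r_star]
  have r_smul_left : ∀ η ξ (c : ℂ) b, r (c • η) ξ b = r η ξ (conj c • b) := fun η ξ c b => by
    rw [r_star, r_smul_right, r_star η ξ, star_smul]
    simp
  have r_le : ∀ η ξ b, r η ξ b ≤ ‖b‖ * ‖η‖ * ‖ξ‖ := fun η ξ b => by
    have := key η b ![ξ] ![1]
    simp only [Fin.sum_univ_one, Matrix.cons_val_fin_one, one_smul, ← mul_pow] at this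
    exact le_of_sq_le_sq this (by positivity)
  -- A complex linear functional is recovered from its real part by `F(b) = Re F(b) - i Re F(ib)`.
  let G : (H →L[ℂ] H) → H → H → ℂ := fun b η ξ => ⟨r η ξ b, - r η ξ (Complex.I • b)⟩
  have r_cs : ∀ η ξ (c : ℂ) b, r η ξ (c • b) = c.re * r η ξ b + c.im * r η ξ (Complex.I • b) :=
      fun η ξ c b => by
    rw [← r_smul, ← r_smul, ← r_add, smul_smul, ← add_smul, Complex.re_add_im]
  have G_smul : ∀ (c : ℂ) b η ξ, G (c • b) η ξ = c * G b η ξ := fun c b η ξ => by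
    apply Complex.ext
    · simp only [G, Complex.mul_re, r_cs η ξ c]
      ring
    · simp only [G, Complex.mul_im, smul_smul, r_cs η ξ (Complex.I * c)]
      simp
  have G_add : ∀ b b' η ξ, G (b + b') η ξ = G b η ξ + G b' η ξ := fun b b' η ξ => by
    apply Complex.ext
    · simp [G, r_add]
    · simp [G, r_add]
      ring
  have G_bound : ∀ b η ξ, ‖G b η ξ‖ ≤ ‖b‖ * ‖η‖ * ‖ξ‖ := fun b η ξ => by
    obtain ⟨c, hc, hc'⟩ := RCLike.exists_norm_eq_mul_self (G b η ξ)
    rw [← G_smul] at hc'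
    have h1 : ‖G b η ξ‖ = r η ξ (c • b) := by
      have := congrArg Complex.re hc'
      simpa [G] using this
    rw [h1]
    refine (r_le _ _ _).trans (by rw [norm_smul, hc, one_mul])
  have ex := fun b => exists_clm_of_sesquilinear (G b) (norm_nonneg b)
    (fun η η' ξ => by
      apply Complex.ext
      · simp [G, r_add_left]
      · simp [G, r_add_left]
        ring)
    (fun c η ξ => by
      rw [← G_smul]
      simp only [G, r_smul_left, smul_smul, mul_comm])
    (fun η ξ ξ' => by
      apply Complex.ext
      · simp [G, r_add_right]
      · simp [G, r_add_right]
        ring)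
    (fun c η ξ => by
      rw [← G_smul]
      simp only [G, r_smul_right, smul_smul, mul_comm]) (G_bound b)
  choose Ψ hΨn hΨ using ex
  let Ψ' : (H →L[ℂ] H) →ₗ[ℂ] (H →L[ℂ] H) :=
    { toFun := Ψ
      map_add' := fun b b' => ContinuousLinearMap.ext fun ξ => ext_inner_left ℂ fun η => by
        rw [add_apply, inner_add_right, hΨ, hΨ, hΨ, G_add]
      map_smul' := fun c b => ContinuousLinearMap.ext fun ξ => ext_inner_left ℂ fun η => by
        rw [RingHom.id_apply, smul_apply, inner_smul_right, hΨ, hΨ, G_smul] }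
  refine ⟨Ψ', fun n a ha ξ => ?_, fun x => ContinuousLinearMap.ext fun ξ =>
    ext_inner_left ℂ fun η => ?_, ContinuousLinearMap.ext fun ξ => ext_inner_left ℂ fun η => ?_⟩
  · have hre : ∀ b η ξ, (⟪η, Ψ' b ξ⟫_ℂ).re = r η ξ b := fun b η ξ => by
      change (⟪η, Ψ b ξ⟫_ℂ).re = r η ξ b
      rw [hΨ]
    simp only [Complex.re_sum, hre, ← r_def, ← map_sum]
    refine hg _ fun v => ?_
    simpa using ha fun i => e (v (ξ i))
  · change ⟪η, Ψ x ξ⟫_ℂ = _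
    rw [hΨ]
    apply Complex.ext
    · exact r_mem η ξ x
    · have := r_mem η ξ (Complex.I • x)
      simp only [G]
      rw [← Submodule.coe_smul, this, map_smul]
      simp
  · change ⟪η, Ψ 1 ξ⟫_ℂ = _
    rw [hΨ]
    apply Complex.ext
    · simpa using r_one η ξ 1
    · have := r_one η ξ Complex.I
      simp only [G, this]
      simp

end Extension

/-! ### Schwarz inequality, Choi–Effros identity, and idempotent extensions. -/

section ChoiEffros

variable {H : Type u} [NormedAddCommGroup H] [InnerProductSpace ℂ H] [CompleteSpace H]

theorem sum_inner_star_mul {ι : Type*} [Fintype ι] (c : ι → H →L[ℂ] H) (v : ι → H) :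
    ∑ i, ∑ j, ⟪v i, (star (c i) * c j) (v j)⟫_ℂ = ⟪∑ i, c i (v i), ∑ i, c i (v i)⟫_ℂ := by
  rw [sum_inner]
  refine Finset.sum_congr rfl fun i _ => ?_
  rw [inner_sum]
  refine Finset.sum_congr rfl fun j _ => ?_
  rw [mul_apply_eq_comp, ContinuousLinearMap.star_eq_adjoint,
    ContinuousLinearMap.adjoint_inner_right]

theorem rpMat_star_mul {ι : Type*} [Fintype ι] (c : ι → H →L[ℂ] H) :
    RPMat fun i j => star (c i) * c j := fun v => by
  rw [sum_inner_star_mul]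
  exact inner_self_nonneg (𝕜 := ℂ)

variable {Ψ : (H →L[ℂ] H) →ₗ[ℂ] (H →L[ℂ] H)}

theorem IsRCP.re_inner_nonneg (hΨ : IsRCP Ψ) {b : H →L[ℂ] H} (hb : ∀ v, 0 ≤ (⟪v, b v⟫_ℂ).re)
    (v : H) : 0 ≤ (⟪v, Ψ b v⟫_ℂ).re := by
  have := hΨ.rpMat (ι := Unit) (a := fun _ _ => b) (fun w => by simpa using hb (w ()))
    (fun _ => v)
  simpa using this

theorem IsRCP.re_inner_mono (hΨ : IsRCP Ψ) {b c : H →L[ℂ] H}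
    (h : ∀ v, (⟪v, b v⟫_ℂ).re ≤ (⟪v, c v⟫_ℂ).re) (v : H) :
    (⟪v, Ψ b v⟫_ℂ).re ≤ (⟪v, Ψ c v⟫_ℂ).re := by
  have := hΨ.re_inner_nonneg (b := c - b)
    (fun w => by simpa [inner_sub_right] using h w) v
  simpa [inner_sub_right] using this

theorem add_star_eq_zero {T : H →L[ℂ] H} (h : ∀ v, (⟪v, T v⟫_ℂ).re = 0) : T + star T = 0 := by
  have key : ((T + star T : H →L[ℂ] H) : H →ₗ[ℂ] H) = 0 := by
    rw [← inner_map_self_eq_zero]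
    intro v
    have h2 : ⟪(T + star T) v, v⟫_ℂ = conj ⟪v, T v⟫_ℂ + ⟪v, T v⟫_ℂ := by
      rw [add_apply, inner_add_left, ContinuousLinearMap.star_eq_adjoint,
        ContinuousLinearMap.adjoint_inner_left, inner_conj_symm]
    change ⟪(T + star T) v, v⟫_ℂ = 0
    rw [h2, add_comm, Complex.add_conj, h v]
    simp
  ext v
  exact congrArg (fun S : H →ₗ[ℂ] H => S v) key

/-- A skew-adjoint `d` has vanishing real form, so both `d` and `-d` are accretive; hence `Ψ d` has
vanishing real form and is skew-adjoint too. This is applied to `b - b*` and `i(b + b*)`. -/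
theorem IsRCP.map_star (hΨ : IsRCP Ψ) (b : H →L[ℂ] H) : Ψ (star b) = star (Ψ b) := by
  have hst : ∀ (c : H →L[ℂ] H) v, (⟪v, (star c) v⟫_ℂ).re = (⟪v, c v⟫_ℂ).re := fun c v => by
    rw [ContinuousLinearMap.star_eq_adjoint, ContinuousLinearMap.adjoint_inner_right,
      ← inner_conj_symm, Complex.conj_re]
  have key : ∀ d : H →L[ℂ] H, star d = -d → star (Ψ d) = -Ψ d := fun d hd => by
    have h0 : ∀ v, (⟪v, d v⟫_ℂ).re = 0 := fun v => by
      have := hst d v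
      rw [hd, neg_apply, inner_neg_right, Complex.neg_re] at this
      linarith
    have := add_star_eq_zero (T := Ψ d) fun v => le_antisymm
      (by simpa using hΨ.re_inner_mono (b := d) (c := 0) (fun w => by simp [h0]) v)
      (hΨ.re_inner_nonneg (fun w => (h0 w).ge) v)
    exact eq_neg_of_add_eq_zero_right this
  have h1 := key (b - star b) (by simp)
  have h2 := key (Complex.I • (b + star b)) (by
    rw [star_smul, star_add, star_star]
    simp only [RCLike.star_def, Complex.conj_I, neg_smul, add_comm])
  simp only [map_sub, map_smul, map_add, star_sub, star_smul, star_add, RCLike.star_def,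
    Complex.conj_I, neg_smul, neg_inj] at h1 h2
  have h3 := smul_right_injective (H →L[ℂ] H) Complex.I_ne_zero h2
  have h4 : (2 : ℂ) • Ψ (star b) = (2 : ℂ) • star (Ψ b) := by
    rw [two_smul, two_smul]
    have h5 : star (Ψ b) + star (Ψ b) = (star (Ψ b) - star (Ψ (star b))) +
      (star (Ψ b) + star (Ψ (star b))) := by abel
    rw [h5, h1, h3]
    abel
  exact smul_right_injective (H →L[ℂ] H) two_ne_zero h4

theorem IsRCP.re_inner_star_mul_le (hΨ : IsRCP Ψ) (h1 : ‖Ψ 1‖ ≤ 1) (c : H →L[ℂ] H) (ξ : H) :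
    (⟪ξ, Ψ (star c * c) ξ⟫_ℂ).re ≤ ‖c‖ ^ 2 * ‖ξ‖ ^ 2 := by
  refine (hΨ.re_inner_mono (c := ((‖c‖ ^ 2 : ℝ) : ℂ) • 1) (fun v => ?_) ξ).trans ?_
  · rw [mul_apply_eq_comp, ContinuousLinearMap.star_eq_adjoint,
      ContinuousLinearMap.adjoint_inner_right, smul_apply, one_apply_eq_self, inner_smul_right,
      Complex.re_ofReal_mul]
    have e1 : (⟪c v, c v⟫_ℂ).re = ‖c v‖ ^ 2 := inner_self_eq_norm_sq (𝕜 := ℂ) (c v)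
    have e2 : (⟪v, v⟫_ℂ).re = ‖v‖ ^ 2 := inner_self_eq_norm_sq (𝕜 := ℂ) v
    rw [e1, e2, ← mul_pow]
    exact pow_le_pow_left₀ (norm_nonneg _) (c.le_opNorm v) 2
  · rw [map_smul, smul_apply, inner_smul_right, Complex.re_ofReal_mul]
    have := (Complex.re_le_norm _).trans (norm_inner_apply_le (Ψ 1) h1 ξ ξ)
    nlinarith [sq_nonneg ‖c‖]

/-- The Cauchy–Schwarz inequality behind the operator Schwarz inequality, in a form that
is linear in the operators. -/
theorem IsRCP.schwarz (hΨ : IsRCP Ψ) (h1 : ‖Ψ 1‖ ≤ 1) (c d : H →L[ℂ] H) (ζ ξ η : H) :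
    0 ≤ ‖ζ‖ ^ 2 + 2 * (⟪ζ, Ψ c ξ⟫_ℂ + ⟪ζ, Ψ d η⟫_ℂ).re +
      (⟪ξ, Ψ (star c * c) ξ⟫_ℂ + ⟪ξ, Ψ (star c * d) η⟫_ℂ + ⟪η, Ψ (star d * c) ξ⟫_ℂ +
        ⟪η, Ψ (star d * d) η⟫_ℂ).re := by
  have h := hΨ.rpMat (rpMat_star_mul ![1, c, d]) ![ζ, ξ, η]
  have hst : ∀ b v, (⟪v, Ψ (star b) ζ⟫_ℂ).re = (⟪ζ, Ψ b v⟫_ℂ).re := fun b v => by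
    rw [hΨ.map_star, ContinuousLinearMap.star_eq_adjoint, ContinuousLinearMap.adjoint_inner_right,
      ← inner_conj_symm, Complex.conj_re]
  simp only [Fin.sum_univ_three, Matrix.cons_val_zero, Matrix.cons_val_one, Matrix.cons_val,
    star_one, one_mul, mul_one, Complex.add_re, hst] at h
  have h2 := (Complex.re_le_norm _).trans (norm_inner_apply_le (Ψ 1) h1 ζ ζ)
  simp only [Complex.add_re]
  linarith

theorem IsRCP.norm_map_le (hΨ : IsRCP Ψ) (h1 : ‖Ψ 1‖ ≤ 1) (c : H →L[ℂ] H) : ‖Ψ c‖ ≤ ‖c‖ := by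
  refine (Ψ c).opNorm_le_bound (norm_nonneg _) fun ξ => ?_
  -- The choice `ζ = -Ψ(c)ξ` minimises the Schwarz expression and gives `‖Ψ(c)ξ‖² ≤ Re ⟪ξ,
  -- Ψ(c*c)ξ⟫`.
  have h := hΨ.schwarz h1 c 0 (-(Ψ c ξ)) ξ 0
  have h2 := hΨ.re_inner_star_mul_le h1 c ξ
  have e1 : (⟪Ψ c ξ, Ψ c ξ⟫_ℂ).re = ‖Ψ c ξ‖ ^ 2 := inner_self_eq_norm_sq (𝕜 := ℂ) _
  simp only [norm_neg, inner_neg_left, map_zero, inner_zero_right, inner_zero_left, add_zero,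
    Complex.neg_re, e1] at h
  refine le_of_sq_le_sq ?_ (by positivity)
  rw [mul_pow]
  linarith

/-- Given an idempotent `Q`, the Choi–Effros identity along weakly convergent families. -/
theorem IsRCP.map_eq_of_wTendsto (hΨ : IsRCP Ψ) (h1 : ‖Ψ 1‖ ≤ 1) (hid : ∀ b, Ψ (Ψ b) = Ψ b)
    {a : H →L[ℂ] H} (ha : Ψ a = a) {α : Type*} (𝒰 : Ultrafilter α) {y : α → H →L[ℂ] H} {C : ℝ}
    (hC : ∀ᶠ t in (𝒰 : Filter α), ‖y t‖ ≤ C) {y₀ z : H →L[ℂ] H}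
    (hy : WTendsto (fun t => Ψ (y t)) 𝒰 y₀) (hz : WTendsto (fun t => Ψ (a * y t)) 𝒰 z) :
    Ψ z = Ψ (a * y₀) := by
  obtain ⟨s, -, hs⟩ := exists_wTendsto 𝒰 (fun t => Ψ (star (y t) * y t)) (C := C * C) (by
    filter_upwards [hC] with t ht
    refine (hΨ.norm_map_le h1 _).trans ((norm_mul_le _ _).trans ?_)
    rw [norm_star]
    exact mul_le_mul ht ht (norm_nonneg _) ((norm_nonneg _).trans ht))
  have hz' : WTendsto (fun t => Ψ (star (y t) * star a)) 𝒰 (star z) := by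
    have := hz.adjoint
    simpa [← hΨ.map_star] using this
  have has : Ψ (star a) = star a := by rw [hΨ.map_star, ha]
  -- The limit of the Schwarz defect of the row `(a*, y_t)`. The corner `s` only has to exist; its
  -- value plays no role.
  have hD : RPMat (![![Ψ (a * star a) - a * star a, z - a * y₀],
      ![star z - star y₀ * star a, s - star y₀ * y₀]] : Fin 2 → Fin 2 → H →L[ℂ] H) := fun v => by
    set ζ := -((star a) (v 0) + y₀ (v 1)) with hζ
    have h2 : 0 ≤ ‖ζ‖ ^ 2 + 2 * (⟪ζ, (star a) (v 0)⟫_ℂ + ⟪ζ, y₀ (v 1)⟫_ℂ).re +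
        (⟪v 0, Ψ (a * star a) (v 0)⟫_ℂ + ⟪v 0, z (v 1)⟫_ℂ + ⟪v 1, (star z) (v 0)⟫_ℂ +
        ⟪v 1, s (v 1)⟫_ℂ).re := by
      refine ge_of_tendsto (((tendsto_const_nhds (x := ‖ζ‖ ^ 2)).add
        (((Complex.continuous_re.tendsto _).comp
          ((tendsto_const_nhds (x := ⟪ζ, (star a) (v 0)⟫_ℂ)).add (hy ζ (v 1)))).const_mul 2)).add
        ((Complex.continuous_re.tendsto _).comp ((((tendsto_const_nhds
          (x := ⟪v 0, Ψ (a * star a) (v 0)⟫_ℂ)).add (hz (v 0) (v 1))).add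
            (hz' (v 1) (v 0))).add (hs (v 1) (v 1))))) (Eventually.of_forall fun t => ?_)
      have := hΨ.schwarz h1 (star a) (y t) ζ (v 0) (v 1)
      rwa [has, star_star] at this
    have h3 : ⟪ζ, (star a) (v 0)⟫_ℂ + ⟪ζ, y₀ (v 1)⟫_ℂ = -⟪ζ, ζ⟫_ℂ := by
      rw [← inner_add_right, ← inner_neg_right, hζ, neg_neg]
    have e1 : (⟪ζ, ζ⟫_ℂ).re = ‖ζ‖ ^ 2 := inner_self_eq_norm_sq (𝕜 := ℂ) _
    have h4 : ⟪ζ, ζ⟫_ℂ = ⟪v 0, (a * star a) (v 0)⟫_ℂ + ⟪v 0, (a * y₀) (v 1)⟫_ℂ +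
        ⟪v 1, (star y₀ * star a) (v 0)⟫_ℂ + ⟪v 1, (star y₀ * y₀) (v 1)⟫_ℂ := by
      have h5 : ⟪(star a) (v 0), (star a) (v 0)⟫_ℂ = ⟪v 0, (a * star a) (v 0)⟫_ℂ := by
        rw [mul_apply_eq_comp, ContinuousLinearMap.star_eq_adjoint,
          ContinuousLinearMap.adjoint_inner_left]
      rw [hζ, inner_neg_neg, inner_add_left, inner_add_right, inner_add_right, h5]
      simp only [mul_apply_eq_comp, ContinuousLinearMap.star_eq_adjoint,
        ContinuousLinearMap.adjoint_inner_right, ContinuousLinearMap.adjoint_inner_left]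
      ring
    rw [h3, Complex.neg_re, e1] at h2
    rw [h4] at e1
    simp only [Fin.sum_univ_two, Matrix.cons_val_zero, Matrix.cons_val_one, sub_apply,
      inner_sub_right, Complex.add_re, Complex.sub_re] at h2 e1 ⊢
    linarith
  -- Applying `Ψ` once more kills the upper left corner, since `Ψ` is idempotent and thus `Ψ(Ψ(aa*)
  -- - aa*) = 0`. A positive matrix with a zero diagonal corner has zero off-diagonal entries.
  have hQD := hΨ.rpMat hD
  have hT : Ψ (star z - star y₀ * star a) = star (Ψ (z - a * y₀)) := by
    rw [← hΨ.map_star, star_sub, star_mul]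
  have key : ∀ v w, 0 ≤ 2 * (⟪v, Ψ (z - a * y₀) w⟫_ℂ).re + (⟪w, Ψ (s - star y₀ * y₀) w⟫_ℂ).re :=
      fun v w => by
    have := hQD ![v, w]
    simp only [Fin.sum_univ_two, Matrix.cons_val_zero, Matrix.cons_val_one] at this
    rw [map_sub Ψ (Ψ (a * star a)), hid, sub_self, hT, ContinuousLinearMap.star_eq_adjoint,
      ContinuousLinearMap.adjoint_inner_right, ← inner_conj_symm (Ψ (z - a * y₀) w) v] at this
    simp only [zero_apply, inner_zero_right, Complex.add_re, Complex.conj_re, Complex.zero_re]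
      at this
    linarith
  have h0 : Ψ (z - a * y₀) = 0 := by
    ext w
    set x := Ψ (z - a * y₀) w with hx
    set r := (⟪w, Ψ (s - star y₀ * y₀) w⟫_ℂ).re
    have e1 : (⟪x, x⟫_ℂ).re = ‖x‖ ^ 2 := inner_self_eq_norm_sq (𝕜 := ℂ) _
    by_contra hx0
    have hpos : 0 < ‖x‖ ^ 2 := by
      have := norm_pos_iff.2 hx0
      positivity
    -- The scalar makes the off-diagonal term equal to `-2(|r| + 1)`, which outweighs the fixed
    -- diagonal term `r`.
    have h5 := key (((-((|r| + 1) / ‖x‖ ^ 2) : ℝ) : ℂ) • x) w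
    rw [← hx, inner_smul_left, Complex.conj_ofReal, Complex.re_ofReal_mul, e1, neg_mul,
      div_mul_cancel₀ _ hpos.ne'] at h5
    linarith [le_abs_self r, abs_nonneg r]
  rw [map_sub] at h0
  exact sub_eq_zero.1 h0

variable {Q : (H →L[ℂ] H) →ₗ[ℂ] (H →L[ℂ] H)}

/-- The Choi–Effros identity for a completely positive idempotent. -/
theorem IsRCP.map_mul_map (hQ : IsRCP Q) (h1 : ‖Q 1‖ ≤ 1) (hid : ∀ b, Q (Q b) = Q b)
    {a : H →L[ℂ] H} (ha : Q a = a) (b : H →L[ℂ] H) : Q (a * Q b) = Q (a * b) := by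
  have := hQ.map_eq_of_wTendsto h1 hid ha (pure () : Ultrafilter Unit) (y := fun _ => b)
    (C := ‖b‖) (Eventually.of_forall fun _ => le_rfl) (wTendsto_const _ _) (wTendsto_const _ _)
  rw [← this, hid]

theorem IsRCP.map_map_mul (hQ : IsRCP Q) (h1 : ‖Q 1‖ ≤ 1) (hid : ∀ b, Q (Q b) = Q b)
    {a : H →L[ℂ] H} (ha : Q a = a) (b : H →L[ℂ] H) : Q (Q b * a) = Q (b * a) := by
  have := hQ.map_mul_map h1 hid (a := star a) (by rw [hQ.map_star, ha]) (star b)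
  rw [hQ.map_star, ← star_mul, ← star_mul, hQ.map_star, hQ.map_star] at this
  exact star_injective this

/-- The maps on `B(H)` that extend a given map and are real completely positive. -/
def rcpExtensions {M : Submodule ℂ (H →L[ℂ] H)} (P : M →ₗ[ℂ] M) (p : M) :
    Set ((H →L[ℂ] H) →ₗ[ℂ] (H →L[ℂ] H)) :=
  {Ψ | IsRCP Ψ ∧ (∀ x : M, Ψ x = P x) ∧ Ψ 1 = p}

/-- An idempotent real completely positive map extends to an idempotent on `B(H)`. -/
theorem exists_idempotent_isRCP_extension {M : Submodule ℂ (H →L[ℂ] H)} {P : M →ₗ[ℂ] M}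
    (hP : IsRealCompletelyPositive P) (hPP : P ∘ₗ P = P)
    {e : H →L[ℂ] H} (he : e ∈ M) (hes : star e = e)
    (hunit : ∀ x ∈ M, e * x = x ∧ x * e = x) (hPe : ‖P ⟨e, he⟩‖ ≤ 1) :
    ∃ Q : (H →L[ℂ] H) →ₗ[ℂ] (H →L[ℂ] H), IsRCP Q ∧ (∀ b, Q (Q b) = Q b) ∧
      (∀ x : M, Q x = P x) ∧ Q 1 = P ⟨e, he⟩ := by
  have hPP' : ∀ x, P (P x) = P x := fun x => congrArg (fun T : M →ₗ[ℂ] M => T x) hPP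
  let E := rcpExtensions P (P ⟨e, he⟩)
  have hE1 : ∀ Ψ : E, ‖Ψ.1 1‖ ≤ 1 := fun Ψ => by
    rw [Ψ.2.2.2]
    exact hPe
  -- Closure under composition rests on `P ∘ P = P`: both `Ψ(Θ x) = P(P x)` on `M` and `Ψ(Θ 1) = P(P
  -- e)`.
  let _ : Semigroup E :=
    { mul := fun Ψ Θ => ⟨Ψ.1 ∘ₗ Θ.1, fun n a ha => Ψ.2.1 n _ (Θ.2.1 n a ha), fun x => by
        rw [LinearMap.comp_apply, Θ.2.2.1, Ψ.2.2.1, hPP'], by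
        rw [LinearMap.comp_apply, Θ.2.2.2, Ψ.2.2.1, hPP']⟩
      mul_assoc := fun _ _ _ => rfl }
  have mul_def : ∀ Ψ Θ : E, (Ψ * Θ).1 = Ψ.1 ∘ₗ Θ.1 := fun _ _ => rfl
  let φ : E → ((H →L[ℂ] H) × H × H → ℂ) := fun Ψ q => ⟪q.2.1, Ψ.1 q.1 q.2.2⟫_ℂ
  let _ : TopologicalSpace E := .induced φ Pi.topologicalSpace
  have hφ : Topology.IsInducing φ := ⟨rfl⟩
  have hφi : Function.Injective φ := fun Ψ Θ h => Subtype.ext <| LinearMap.ext fun b =>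
    ContinuousLinearMap.ext fun ξ => ext_inner_left ℂ fun η => congrFun h (b, η, ξ)
  have : T2Space E := T2Space.of_injective_continuous hφi hφ.continuous
  have : Nonempty E := by
    obtain ⟨Ψ, h⟩ := exists_isRCP_extension hP he hes hunit hPe
    exact ⟨⟨Ψ, h⟩⟩
  have : CompactSpace E := by
    rw [← isCompact_univ_iff, isCompact_iff_ultrafilter_le_nhds]
    intro 𝒰 _
    have ex := fun b => exists_wTendsto 𝒰 (fun Ψ : E => Ψ.1 b) (C := ‖b‖)
      (Eventually.of_forall fun Ψ => Ψ.2.1.norm_map_le (hE1 Ψ) b)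
    choose T hTn hT using ex
    let Θ : (H →L[ℂ] H) →ₗ[ℂ] (H →L[ℂ] H) :=
      { toFun := T
        map_add' := fun b c => (hT (b + c)).unique (by simpa using (hT b).add (hT c))
        map_smul' := fun r b => (hT (r • b)).unique (by simpa using (hT b).const_smul r) }
    refine ⟨⟨Θ, fun n a ha v => ?_, fun x => ?_, ?_⟩, trivial, ?_⟩
    · refine ge_of_tendsto ((Complex.continuous_re.tendsto _).comp
        (tendsto_finsetSum _ fun i _ => tendsto_finsetSum _ fun j _ => hT (a i j) (v i) (v j)))
        (Eventually.of_forall fun Ψ => Ψ.2.1 n a ha v)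
    · refine (hT x).unique ?_
      simp only [fun Ψ : E => Ψ.2.2.1 x]
      exact wTendsto_const _ _
    · refine (hT 1).unique ?_
      simp only [fun Ψ : E => Ψ.2.2.2]
      exact wTendsto_const _ _
    · rw [hφ.nhds_eq_comap, ← tendsto_iff_comap, tendsto_pi_nhds]
      exact fun q => hT q.1 q.2.1 q.2.2
  -- Ellis–Numakura. Only continuity in the left factor is available: evaluating `Ψ ∘ Θ` at `b` is
  -- evaluating `Ψ` at the fixed operator `Θ b`.
  obtain ⟨Q, hQ⟩ := exists_idempotent_of_compact_t2_of_continuous_mul_left (M := E) fun Θ => by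
    rw [hφ.continuous_iff, continuous_pi_iff]
    intro q
    exact (continuous_apply (Θ.1 q.1, q.2.1, q.2.2)).comp hφ.continuous
  refine ⟨Q.1, Q.2.1, fun b => ?_, Q.2.2.1, Q.2.2.2⟩
  have := congrArg Subtype.val hQ
  rw [mul_def] at this
  exact congrArg (fun T : (H →L[ℂ] H) →ₗ[ℂ] (H →L[ℂ] H) => T b) this

end ChoiEffros

/-! ### Stinespring-type representation of the range of an idempotent. -/

section Dilation

variable {H : Type u} [NormedAddCommGroup H] [InnerProductSpace ℂ H] [CompleteSpace H]

/-- The Kolmogorov decomposition of a positive semidefinite operator valued kernel. -/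
theorem exists_kolmogorov {X : Type u} (k : X → X → H →L[ℂ] H) (hk : ∀ x y, star (k x y) = k y x)
    (hpos : ∀ (s : Finset X) (v : X → H), 0 ≤ (∑ x ∈ s, ∑ y ∈ s, ⟪v x, k x y (v y)⟫_ℂ).re) :
    ∃ (K : Type u) (_ : NormedAddCommGroup K) (_ : InnerProductSpace ℂ K) (_ : CompleteSpace K)
      (j : X → H →L[ℂ] K), (∀ x y ξ η, ⟪j x ξ, j y η⟫_ℂ = ⟪ξ, k x y η⟫_ℂ) ∧
        DenseRange (Finsupp.lsum ℂ fun x => (j x : H →ₗ[ℂ] K)) := by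
  have hK : (Matrix.of k).PosSemidef := by
    have htfae := (RKHS.posSemidef_tfae (K := Matrix.of k)).out 0 2
    refine htfae.2 ⟨?_, fun v => ?_⟩
    · ext1 x y
      exact hk y x
    · have := hpos v.support v
      rw [Finset.sum_comm, ← Complex.conj_re, map_sum] at this
      simp only [map_sum, inner_conj_symm] at this
      exact this
  have : Fact (Matrix.of k).PosSemidef := ⟨hK⟩
  refine ⟨RKHS.OfKernel (Matrix.of k), inferInstance, inferInstance, inferInstance,
    RKHS.kerFun (RKHS.OfKernel (Matrix.of k)), fun x y ξ η => ?_, ?_⟩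
  · rw [← ContinuousLinearMap.adjoint_inner_right, RKHS.adjoint_kerFun, RKHS.kerFun_apply,
      RKHS.OfKernel.kernel_ofKernel]
    rfl
  · have := RKHS.kerFun_dense (RKHS.OfKernel (Matrix.of k))
    have h2 : Submodule.span ℂ {RKHS.kerFun (RKHS.OfKernel (Matrix.of k)) x v | (x) (v)} ≤
        LinearMap.range (Finsupp.lsum ℂ fun x =>
          (RKHS.kerFun (RKHS.OfKernel (Matrix.of k)) x : H →ₗ[ℂ] RKHS.OfKernel (Matrix.of k))) := by
      rw [Submodule.span_le]
      rintro _ ⟨x, v, rfl⟩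
      exact ⟨Finsupp.single x v, by simp⟩
    rw [← Submodule.dense_iff_topologicalClosure_eq_top] at this
    exact this.mono h2

variable {Q : (H →L[ℂ] H) →ₗ[ℂ] (H →L[ℂ] H)}

/-- The bound on `a` says `C² - a*a ≥ 0`; multiplying by the operators `y` on both sides keeps
positivity, and `Q` is applied entrywise to the result. In the dilation this is the bound on left
multiplication by `a`, at all matrix levels. -/
theorem IsRCP.sum_re_inner_le (hQ : IsRCP Q) {n : ℕ} {ι : Type*} [Fintype ι]
    (a : Fin n → Fin n → H →L[ℂ] H) (y : ι → H →L[ℂ] H) {C : ℝ}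
    (ha : ∀ v : Fin n → H, ∑ i, ‖∑ j, a i j (v j)‖ ^ 2 ≤ C ^ 2 * ∑ j, ‖v j‖ ^ 2)
    (w : Fin n → ι → H) :
    (∑ i, ∑ p : Fin n × ι, ∑ q : Fin n × ι,
      ⟪w p.1 p.2, Q (star (a i p.1 * y p.2) * (a i q.1 * y q.2)) (w q.1 q.2)⟫_ℂ).re ≤
    C ^ 2 * (∑ j, ∑ x, ∑ z, ⟪w j x, Q (star (y x) * y z) (w j z)⟫_ℂ).re := by
  classical
  let N : Fin n × ι → Fin n × ι → H →L[ℂ] H := fun p q =>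
    (if p.1 = q.1 then ((C ^ 2 : ℝ) : ℂ) • (star (y p.2) * y q.2) else 0) -
      ∑ i, star (a i p.1 * y p.2) * (a i q.1 * y q.2)
  have expand : ∀ (T : (H →L[ℂ] H) →ₗ[ℂ] (H →L[ℂ] H)) (v : Fin n × ι → H),
      ∑ p, ∑ q, ⟪v p, T (N p q) (v q)⟫_ℂ =
        ((C ^ 2 : ℝ) : ℂ) * ∑ j, ∑ x, ∑ z, ⟪v (j, x), T (star (y x) * y z) (v (j, z))⟫_ℂ -
        ∑ i, ∑ p, ∑ q, ⟪v p, T (star (a i p.1 * y p.2) * (a i q.1 * y q.2)) (v q)⟫_ℂ := by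
    intro T v
    have h1 : ∀ p q, ⟪v p, T (N p q) (v q)⟫_ℂ =
        (if p.1 = q.1 then ((C ^ 2 : ℝ) : ℂ) * ⟪v p, T (star (y p.2) * y q.2) (v q)⟫_ℂ else 0) -
        ∑ i, ⟪v p, T (star (a i p.1 * y p.2) * (a i q.1 * y q.2)) (v q)⟫_ℂ := fun p q => by
      simp only [N, map_sub, sub_apply, inner_sub_right, map_sum, sum_apply, inner_sum]
      split_ifs
      · rw [map_smul, smul_apply, inner_smul_right]
      · simp
    simp only [h1, Finset.sum_sub_distrib]
    congr 1
    · simp only [Fintype.sum_prod_type, Finset.mul_sum]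
      refine Finset.sum_congr rfl fun j _ => Finset.sum_congr rfl fun x _ => ?_
      rw [Finset.sum_comm]
      simp
    · symm
      rw [Finset.sum_comm]
      refine Finset.sum_congr rfl fun p _ => ?_
      rw [Finset.sum_comm]
  have hN : RPMat N := fun v => by
    have h := expand LinearMap.id v
    simp only [LinearMap.id_apply] at h
    rw [h, Complex.sub_re, Complex.re_ofReal_mul, sub_nonneg, Complex.re_sum, Complex.re_sum]
    have h1 : ∀ z : H, (⟪z, z⟫_ℂ).re = ‖z‖ ^ 2 := fun z => inner_self_eq_norm_sq (𝕜 := ℂ) z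
    have h2 : ∀ i, (∑ p : Fin n × ι, ∑ q : Fin n × ι,
        ⟪v p, (star (a i p.1 * y p.2) * (a i q.1 * y q.2)) (v q)⟫_ℂ).re =
        ‖∑ j, a i j (∑ x, y x (v (j, x)))‖ ^ 2 := fun i => by
      rw [sum_inner_star_mul (fun p : Fin n × ι => a i p.1 * y p.2), h1, Fintype.sum_prod_type]
      simp only [mul_apply_eq_comp, map_sum]
    have h3 : ∀ j, (∑ x, ∑ z, ⟪v (j, x), (star (y x) * y z) (v (j, z))⟫_ℂ).re =
        ‖∑ x, y x (v (j, x))‖ ^ 2 := fun j => by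
      rw [sum_inner_star_mul y fun x => v (j, x), h1]
    rw [Finset.sum_congr rfl fun i _ => h2 i, Finset.sum_congr rfl fun j _ => h3 j]
    exact ha fun j => ∑ x, y x (v (j, x))
  have h := hQ.rpMat hN fun p => w p.1 p.2
  rw [expand Q, Complex.sub_re, Complex.re_ofReal_mul, sub_nonneg] at h
  exact h

/-- The dilation of a completely positive idempotent `Q`: the range of `Q`, with the product
`(x, y) ↦ Q (x * y)`, is represented on a Hilbert space that contains a contractive image of `H`
to which the representation compresses as the identity. -/
theorem exists_dilation (hQ : IsRCP Q) (h1 : ‖Q 1‖ ≤ 1) (hid : ∀ b, Q (Q b) = Q b) :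
    ∃ (K : Type u) (_ : NormedAddCommGroup K) (_ : InnerProductSpace ℂ K) (_ : CompleteSpace K)
      (σ : LinearMap.range Q →ₗ[ℂ] (K →L[ℂ] K)) (V : H →L[ℂ] K),
      (∀ (n : ℕ) (a : Matrix (Fin n) (Fin n) (LinearMap.range Q)),
        ‖matOp (a.map σ)‖ ≤ ‖subMatOp (LinearMap.range Q) a‖) ∧
      ‖V‖ ≤ 1 ∧ (∀ x η ξ, ⟪V η, σ x (V ξ)⟫_ℂ = ⟪η, (x : H →L[ℂ] H) ξ⟫_ℂ) ∧
      (∀ x y z : LinearMap.range Q, Q (x * y) = z → σ x * σ y = σ z) ∧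
      (∀ u : LinearMap.range Q, Q 1 = u → σ u = 1) := by
  -- The Stinespring inner product for the Choi–Effros product on the range of `Q`. Indexing by all
  -- operators is harmless because `k` depends on `b` and `c` only through `Q b` and `Q c`.
  let k : (H →L[ℂ] H) → (H →L[ℂ] H) → H →L[ℂ] H := fun b c => Q (star (Q b) * Q c)
  have hR : ∀ x : LinearMap.range Q, Q x = x := by
    rintro ⟨_, b, rfl⟩
    exact hid b
  have hRs : ∀ {a}, Q a = a → Q (star a) = star a := fun {a} ha => by rw [hQ.map_star, ha]
  have mm := fun {a} (ha : Q a = a) b => hQ.map_mul_map h1 hid ha b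
  have mm' := fun {a} (ha : Q a = a) b => hQ.map_map_mul h1 hid ha b
  have hk2 : ∀ a a', Q a = a → Q a' = a' → ∀ b b',
      k (a * b) (a' * b') = Q (star (a * Q b) * (a' * Q b')) := fun a a' ha ha' b b' => by
    have e1 : Q (a * b) = Q (a * Q b) := (mm ha b).symm
    have e2 : Q (a' * b') = Q (a' * Q b') := (mm ha' b').symm
    change Q (star (Q (a * b)) * Q (a' * b')) = _
    rw [e1, e2, ← hQ.map_star, mm' (hid _), star_mul, mul_assoc, ← mm (hRs (hid b)),
      mm (hRs ha), mm (hRs (hid b)), mul_assoc]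
  obtain ⟨K, _, _, _, j, hj, hdense⟩ := exists_kolmogorov k
    (fun x y => by
      change star (Q _) = Q _
      rw [← hQ.map_star, star_mul, star_star])
    (fun s v => by
      have := hQ.rpMat (rpMat_star_mul fun x : s => Q x) fun x => v x
      rw [← Finset.sum_coe_sort s]
      simp only [← Finset.sum_coe_sort s]
      exact this)
  set E := Finsupp.lsum ℂ fun x => (j x : H →ₗ[ℂ] K) with hE
  have hEs : ∀ b ξ, E (Finsupp.single b ξ) = j b ξ := fun b ξ => by simp [E]
  -- vectors and operators are determined by the spanning vectors
  have ext_op : ∀ S T : K →L[ℂ] K, (∀ b ξ, S (j b ξ) = T (j b ξ)) → S = T := fun S T h => by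
    have : (S : K → K) ∘ E = (T : K → K) ∘ E := by
      have h2 : (S : K →ₗ[ℂ] K) ∘ₗ E = (T : K →ₗ[ℂ] K) ∘ₗ E := by
        ext b ξ
        simpa [E] using h b ξ
      exact congrArg DFunLike.coe h2
    exact DFunLike.coe_injective (hdense.equalizer S.continuous T.continuous this)
  have ext_vec : ∀ v w : K, (∀ b ξ, ⟪j b ξ, v⟫_ℂ = ⟪j b ξ, w⟫_ℂ) → v = w := fun v w h => by
    have : (fun z : K => ⟪v - w, z⟫_ℂ) = fun _ => 0 := by
      refine hdense.equalizer (by fun_prop) continuous_const (funext fun f => ?_)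
      simp only [Function.comp_apply]
      induction f using Finsupp.induction_linear with
      | zero => simp
      | add f g hf hg => rw [map_add, inner_add_right, hf, hg, add_zero]
      | single b ξ => rw [hEs, ← inner_conj_symm, inner_sub_right, h, sub_self, map_zero]
    have h0 := congrFun this (v - w)
    exact sub_eq_zero.1 (inner_self_eq_zero.1 h0)
  have j_congr : ∀ b c, Q b = Q c → ∀ ξ, j b ξ = j c ξ := fun b c h ξ => ext_vec _ _ fun d η => by
    rw [hj, hj]
    simp only [k, h]
  have j_add : ∀ b c ξ, j (b + c) ξ = j b ξ + j c ξ := fun b c ξ => ext_vec _ _ fun d η => by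
    rw [inner_add_right, hj, hj, hj, ← inner_add_right, ← add_apply]
    simp only [k, map_add, mul_add]
  have j_smul : ∀ (r : ℂ) b ξ, j (r • b) ξ = r • j b ξ := fun r b ξ => ext_vec _ _ fun d η => by
    rw [inner_smul_right, hj, hj, ← inner_smul_right, ← smul_apply]
    simp only [k, map_smul, mul_smul_comm]
  -- Left multiplication by `a`, defined on formal sums; it descends to `K` once it is bounded by
  -- the norm of the image under `E`.
  let L : (H →L[ℂ] H) → ((H →L[ℂ] H) →₀ H) →ₗ[ℂ] K := fun a =>
    Finsupp.lsum ℂ fun b => (j (a * b) : H →ₗ[ℂ] K)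
  have norm_sum : ∀ {ι : Type u} [Fintype ι] (b : ι → H →L[ℂ] H) (w : ι → H),
      ‖∑ p, j (b p) (w p)‖ ^ 2 = (∑ p, ∑ q, ⟪w p, k (b p) (b q) (w q)⟫_ℂ).re := by
    intro ι _ b w
    rw [← inner_self_eq_norm_sq (𝕜 := ℂ), sum_inner]
    simp only [inner_sum, hj]
    rfl
  -- The case `n = 1` bounds each operator and so lets it extend to `K`; general `n` gives complete
  -- contractivity of the representation.
  have main : ∀ {n : ℕ} (a : Fin n → Fin n → H →L[ℂ] H), (∀ i j, Q (a i j) = a i j) → ∀ {C : ℝ},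
      (∀ v : Fin n → H, ∑ i, ‖∑ j, a i j (v j)‖ ^ 2 ≤ C ^ 2 * ∑ j, ‖v j‖ ^ 2) →
      ∀ f : Fin n → (H →L[ℂ] H) →₀ H,
        ∑ i, ‖∑ j, L (a i j) (f j)‖ ^ 2 ≤ C ^ 2 * ∑ j, ‖E (f j)‖ ^ 2 := by
    classical
    intro n a haR C ha f
    let s : Finset (H →L[ℂ] H) := Finset.univ.biUnion fun j => (f j).support
    have hs : ∀ i, (f i).support ⊆ s := fun i =>
      Finset.subset_biUnion_of_mem (fun j => (f j).support) (Finset.mem_univ i)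
    have key : ∀ (h : (H →L[ℂ] H) → H →ₗ[ℂ] K) i, Finsupp.lsum ℂ h (f i)
        = ∑ x : s, h x (f i x) := fun h i => by
      rw [Finsupp.lsum_apply, Finsupp.sum_of_support_subset _ (hs i) _ (fun _ _ => map_zero _),
        ← Finset.sum_coe_sort s]
    have h3 := hQ.sum_re_inner_le a (fun x : s => Q x) ha (fun i x => f i x)
    have h4 : ∀ i, ‖∑ j, L (a i j) (f j)‖ ^ 2 = (∑ p : Fin n × s, ∑ q : Fin n × s,
        ⟪f p.1 p.2, Q (star (a i p.1 * Q p.2) * (a i q.1 * Q q.2)) (f q.1 q.2)⟫_ℂ).re := fun i => by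
      have := norm_sum (fun p : Fin n × s => a i p.1 * p.2) (fun p => f p.1 p.2)
      rw [Fintype.sum_prod_type] at this
      simp only [L, key]
      refine this.trans ?_
      simp only [hk2 _ _ (haR i _) (haR i _)]
    have h5 : ∀ i, ‖E (f i)‖ ^ 2 = (∑ x : s, ∑ z : s,
        ⟪f i x, Q (star (Q x) * Q z) (f i z)⟫_ℂ).re := fun i => by
      rw [hE, key]
      exact norm_sum (fun x : s => (x : H →L[ℂ] H)) fun x => f i x
    simp only [h4, h5]
    simpa only [Complex.re_sum] using h3
  have bound1 : ∀ a, Q a = a → ∀ f, ‖L a f‖ ≤ ‖a‖ * ‖E f‖ := fun a ha f => by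
    have := main (n := 1) (fun _ _ => a) (fun _ _ => ha) (C := ‖a‖) (fun v => by
      simpa [← mul_pow] using pow_le_pow_left₀ (norm_nonneg _) (a.le_opNorm (v 0)) 2) (fun _ => f)
    simp only [Finset.univ_unique, Finset.sum_singleton, ← mul_pow] at this
    exact le_of_sq_le_sq this (by positivity)
  let σ₀ : (H →L[ℂ] H) → K →L[ℂ] K := fun a => (L a).extendOfNorm E
  have hσE : ∀ a, Q a = a → ∀ f, σ₀ a (E f) = L a f := fun a ha f =>
    LinearMap.extendOfNorm_eq hdense ⟨_, bound1 a ha⟩ f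
  have hσ : ∀ a, Q a = a → ∀ b ξ, σ₀ a (j b ξ) = j (a * b) ξ := fun a ha b ξ => by
    rw [← hEs, hσE a ha]
    simp [L]
  let σ : LinearMap.range Q →ₗ[ℂ] (K →L[ℂ] K) :=
    { toFun := fun x => σ₀ x
      map_add' := fun x y => ext_op _ _ fun b ξ => by
        rw [hσ _ (hR _), add_apply, hσ _ (hR x), hσ _ (hR y), Submodule.coe_add, add_mul, j_add]
      map_smul' := fun r x => ext_op _ _ fun b ξ => by
        rw [hσ _ (hR _), RingHom.id_apply, smul_apply, hσ _ (hR x), Submodule.coe_smul,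
          smul_mul_assoc, j_smul] }
  have hσj : ∀ x b ξ, σ x (j b ξ) = j (x * b) ξ := fun x b ξ => hσ x (hR x) b ξ
  refine ⟨K, inferInstance, inferInstance, inferInstance, σ, j 1, fun n a => ?_, ?_,
    fun x η ξ => ?_, fun x y z hz => ext_op _ _ fun b ξ => ?_,
    fun u hu => ext_op _ _ fun b ξ => ?_⟩
  · rw [norm_matOp_le_iff _ (norm_nonneg _)]
    have ha := (norm_matOp_le_iff (a.map fun x => (x : H →L[ℂ] H)) (norm_nonneg (subMatOp _ a))).1
      le_rfl
    intro v
    refine (DenseRange.piMap fun _ : Fin n => hdense).induction_on v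
      (isClosed_le (by fun_prop) (by fun_prop)) fun f => ?_
    have := main (fun i j => (a i j : H →L[ℂ] H)) (fun i j => hR _) ha f
    simpa only [Pi.map_apply, Matrix.map_apply, hσE _ (hR _), σ, LinearMap.coe_mk, AddHom.coe_mk]
      using this
  · refine (j 1).opNorm_le_bound zero_le_one fun ξ => ?_
    have h2 : ‖j 1 ξ‖ ^ 2 ≤ ‖ξ‖ ^ 2 := by
      rw [← inner_self_eq_norm_sq (𝕜 := ℂ), hj]
      have e1 : k 1 1 = Q 1 := by
        change Q (star (Q 1) * Q 1) = Q 1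
        rw [← hQ.map_star, star_one, mm (hid 1), mul_one, hid]
      rw [e1]
      have := (Complex.re_le_norm _).trans (norm_inner_apply_le (Q 1) h1 ξ ξ)
      rw [one_mul, ← sq] at this
      exact this
    rw [one_mul]
    exact le_of_sq_le_sq h2 (norm_nonneg _)
  · rw [hσj, hj]
    have e1 : k 1 (x * 1) = x := by
      change Q (star (Q 1) * Q (x * 1)) = x
      rw [← hQ.map_star, star_one, mul_one, hR, mm' (hR x), one_mul, hR]
    rw [e1]
  · rw [mul_apply_eq_comp, hσj, hσj, hσj]
    refine j_congr _ _ ?_ ξ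
    -- Associativity of the Choi–Effros product: `Q(x(yb)) = Q(xy Q(b)) = Q(Q(xy) Q(b)) = Q(zb)`.
    rw [← mm (hR x), ← mm (hR y), mm (hR x), ← mul_assoc, ← mm' (hid b), hz, mm (hR z)]
  · rw [hσj, one_apply_eq_self]
    refine j_congr _ _ ?_ ξ
    rw [← mm (hR u), ← hu, mm' (hid b), one_mul, hid]

end Dilation

/-! ### The Krein–Šmulian theorem for subspaces, by separation in `c₀`. -/

section KreinSmulian

open ZeroAtInfty

/-- Bounded functionals on `c₀` are given by absolutely summable sequences. -/
theorem exists_summable_of_dual_zeroAtInfty (φ : StrongDual ℂ C₀(ℕ, ℂ)) :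
    ∃ a : ℕ → ℂ, Summable (fun m => ‖a m‖) ∧ ∀ f : C₀(ℕ, ℂ), φ f = ∑' m, a m * f m := by
  have hfin : ∀ (s : Finset ℕ) (g : ℕ → ℂ),
      Tendsto (fun m => if m ∈ s then g m else 0) (cocompact ℕ) (𝓝 0) := fun s g => by
    refine tendsto_const_nhds.congr' ?_
    rw [cocompact_eq_cofinite]
    filter_upwards [s.finite_toSet.compl_mem_cofinite] with m hm
    exact (if_neg hm).symm
  let cut : Finset ℕ → (ℕ → ℂ) → C₀(ℕ, ℂ) := fun s g =>
    ⟨⟨fun m => if m ∈ s then g m else 0, continuous_of_discreteTopology⟩, hfin s g⟩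
  have cut_apply : ∀ s g m, cut s g m = if m ∈ s then g m else 0 := fun _ _ _ => rfl
  let δ : ℕ → C₀(ℕ, ℂ) := fun m => cut {m} fun _ => 1
  have cut_eq : ∀ s g, cut s g = ∑ m ∈ s, g m • δ m := fun s g => by
    ext k
    have : (∑ m ∈ s, g m • δ m) k = ∑ m ∈ s, (g m • δ m) k := by
      induction s using Finset.induction_on with
      | empty => rfl
      | insert i s hi ih => rw [Finset.sum_insert hi, Finset.sum_insert hi, ← ih]; rfl
    rw [this, cut_apply]
    simp [δ, cut_apply, ZeroAtInftyContinuousMap.smul_apply]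
  have norm_le : ∀ (f : C₀(ℕ, ℂ)) {C : ℝ}, 0 ≤ C → (∀ m, ‖f m‖ ≤ C) → ‖f‖ ≤ C :=
    fun f C hC h => by
      rw [← ZeroAtInftyContinuousMap.norm_toBCF_eq_norm]
      exact (BoundedContinuousFunction.norm_le hC).2 h
  let a : ℕ → ℂ := fun m => φ (δ m)
  have hsum : Summable fun m => ‖a m‖ := by
    refine summable_of_sum_le (c := ‖φ‖) (fun m => norm_nonneg _) fun s => ?_
    have ex : ∀ m, ∃ c : ℂ, ‖c‖ = 1 ∧ ((‖a m‖ : ℝ) : ℂ) = c * a m := fun m =>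
      RCLike.exists_norm_eq_mul_self (a m)
    choose c hc hca using ex
    have h1 : φ (cut s c) = ((∑ m ∈ s, ‖a m‖ : ℝ) : ℂ) := by
      rw [cut_eq, map_sum, Complex.ofReal_sum]
      refine Finset.sum_congr rfl fun m _ => ?_
      rw [map_smul, hca]
      rfl
    have h2 : ‖cut s c‖ ≤ 1 := norm_le _ zero_le_one fun m => by
      rw [cut_apply]
      split_ifs
      · exact (hc m).le
      · simp
    have h3 := φ.le_opNorm (cut s c)
    rw [h1, Complex.norm_real, Real.norm_of_nonneg (Finset.sum_nonneg fun _ _ => norm_nonneg _)]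
      at h3
    exact h3.trans (mul_le_of_le_one_right (norm_nonneg _) h2)
  refine ⟨a, hsum, fun f => ?_⟩
  have h4 : Tendsto (fun s : Finset ℕ => cut s f) atTop (𝓝 f) := by
    rw [Metric.tendsto_atTop]
    intro ε hε
    have hf := (zero_at_infty f)
    rw [cocompact_eq_cofinite] at hf
    have hf' := hf.eventually (Metric.ball_mem_nhds (0 : ℂ) (half_pos hε))
    rw [eventually_cofinite] at hf'
    refine ⟨hf'.toFinset, fun s hs => ?_⟩
    rw [dist_eq_norm]
    refine (norm_le _ (half_pos hε).le fun m => ?_).trans_lt (half_lt_self hε)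
    rw [ZeroAtInftyContinuousMap.sub_apply, cut_apply]
    split_ifs with hm
    · simpa using (half_pos hε).le
    · have : m ∉ hf'.toFinset := fun h => hm (hs h)
      simp only [Set.Finite.mem_toFinset, Set.mem_ofPred_eq, not_not] at this
      simpa using (mem_ball_zero_iff.1 this).le
  have h5 : HasSum (fun m => a m * f m) (φ f) := by
    refine ((φ.continuous.tendsto f).comp h4).congr fun s => ?_
    rw [Function.comp_apply, cut_eq, map_sum]
    refine Finset.sum_congr rfl fun m _ => ?_
    rw [map_smul, smul_eq_mul, mul_comm]
  exact h5.tsum_eq.symm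

variable {H : Type u} [NormedAddCommGroup H] [InnerProductSpace ℂ H] [CompleteSpace H]

/-- Separation of a point from a subspace by an absolutely convergent combination of
vector functionals. -/
theorem exists_separating_sequence {S : Submodule ℂ (H →L[ℂ] H)} {x₀ : H →L[ℂ] H}
    {η ξ : ℕ → H} (hη : ∀ m, ‖η m‖ ≤ 1) (hξ : Tendsto (fun m => ‖ξ m‖) cofinite (𝓝 0))
    (h : ∀ x ∈ S, ∃ m, 1 < ‖⟪η m, (x - x₀) (ξ m)⟫_ℂ‖) :
    ∃ a : ℕ → ℂ, Summable (fun m => ‖a m‖) ∧ (∀ x ∈ S, ∑' m, a m * ⟪η m, x (ξ m)⟫_ℂ = 0) ∧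
      ∑' m, a m * ⟪η m, x₀ (ξ m)⟫_ℂ ≠ 0 := by
  let T : (H →L[ℂ] H) →ₗ[ℂ] C₀(ℕ, ℂ) :=
    { toFun := fun x => ⟨⟨fun m => ⟪η m, x (ξ m)⟫_ℂ, continuous_of_discreteTopology⟩, by
        change Tendsto (fun m => ⟪η m, x (ξ m)⟫_ℂ) (cocompact ℕ) (𝓝 0)
        rw [cocompact_eq_cofinite]
        refine squeeze_zero_norm (fun m => ?_) (by simpa using hξ.const_mul ‖x‖)
        refine (norm_inner_apply_le x le_rfl _ _).trans ?_
        gcongr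
        exact mul_le_of_le_one_left (norm_nonneg _) (hη m)⟩
      map_add' := fun x y => by
        ext m
        exact inner_add_right _ _ _
      map_smul' := fun c x => by
        ext m
        exact inner_smul_right _ _ _ }
  have T_apply : ∀ x m, T x m = ⟪η m, x (ξ m)⟫_ℂ := fun _ _ => rfl
  obtain ⟨p, hp, hle, hx₀⟩ : ∃ p : Submodule ℂ C₀(ℕ, ℂ), IsClosed (p : Set C₀(ℕ, ℂ)) ∧
      S.map T ≤ p ∧ T x₀ ∉ p := by
    -- By hypothesis every point of the image of `S` differs from `T x₀` by more than `1` in some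
    -- coordinate, so the closure misses `T x₀` and Hahn–Banach applies.
    refine ⟨(S.map T).topologicalClosure, Submodule.isClosed_topologicalClosure _,
      Submodule.le_topologicalClosure _, fun hmem => ?_⟩
    have hmem : T x₀ ∈ closure (S.map T : Set C₀(ℕ, ℂ)) := hmem
    rw [Metric.mem_closure_iff] at hmem
    obtain ⟨_, ⟨x, hx, rfl⟩, hd⟩ := hmem 1 one_pos
    obtain ⟨m, hm⟩ := h x hx
    rw [dist_comm, dist_eq_norm, ← map_sub, ← ZeroAtInftyContinuousMap.norm_toBCF_eq_norm] at hd
    exact absurd hd (not_lt.2 (hm.le.trans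
      (BoundedContinuousFunction.norm_coe_le_norm (T (x - x₀)).toBCF m)))
  have hne : ‖p.mkQ (T x₀)‖ ≠ 0 := by
    refine (norm_ne_zero_iff (E := C₀(ℕ, ℂ) ⧸ p)).2 fun h0 => ?_
    exact hx₀ ((Submodule.Quotient.mk_eq_zero p).1 h0)
  obtain ⟨g, -, hg⟩ := exists_dual_vector ℂ (p.mkQ (T x₀)) hne
  obtain ⟨a, ha, hφ⟩ := exists_summable_of_dual_zeroAtInfty (g.comp p.mkQL)
  refine ⟨a, ha, fun x hx => ?_, ?_⟩
  · have := hφ (T x)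
    simp only [T_apply] at this
    rw [← this, ContinuousLinearMap.comp_apply]
    have h0 : p.mkQL (T x) = 0 := (Submodule.Quotient.mk_eq_zero p).2
      (hle (Submodule.mem_map_of_mem hx))
    rw [h0, map_zero]
  · have := hφ (T x₀)
    simp only [T_apply] at this
    rw [← this, ContinuousLinearMap.comp_apply]
    change g (p.mkQ (T x₀)) ≠ 0
    rw [hg]
    simpa using hne

/-- Each coefficient is split into two factors of modulus `√‖a m‖`, one for each vector sequence, so
an `ℓ¹` combination of bounded vector functionals is a weak* functional. Where `a m = 0`, division
by zero returns the required value `0`. -/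
theorem exists_lp_of_summable {a : ℕ → ℂ} (ha : Summable fun m => ‖a m‖) {η ξ : ℕ → H}
    {C : ℝ} (hη : ∀ m, ‖η m‖ ≤ C) (hξ : ∀ m, ‖ξ m‖ ≤ C) :
    ∃ p : lp (fun _ : ℕ => H) 2 × lp (fun _ : ℕ => H) 2, ∀ (x : H →L[ℂ] H) (m : ℕ),
      ⟪p.2 m, x (p.1 m)⟫_ℂ = a m * ⟪η m, x (ξ m)⟫_ℂ := by
  have key : ∀ ζ : ℕ → H, ∀ b : ℕ → ℂ, (∀ m, ‖b m‖ = √‖a m‖) → (∀ m, ‖ζ m‖ ≤ C) →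
      Memℓp (fun m => b m • ζ m) 2 := fun ζ b hb hζ => by
    refine memℓp_gen (Summable.of_nonneg_of_le (fun m => by positivity) (fun m => ?_)
      (ha.mul_right (C ^ 2)))
    rw [ENNReal.toReal_ofNat, Real.rpow_ofNat, norm_smul, hb, mul_pow,
      Real.sq_sqrt (norm_nonneg _)]
    gcongr
    exact hζ m
  refine ⟨(⟨fun m => ((√‖a m‖ : ℝ) : ℂ) • ξ m, key ξ (fun m => ((√‖a m‖ : ℝ) : ℂ)) (fun m => by
    rw [Complex.norm_real, Real.norm_of_nonneg (Real.sqrt_nonneg _)]) hξ⟩,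
    ⟨fun m => (conj (a m) / ((√‖a m‖ : ℝ) : ℂ)) • η m,
      key η (fun m => conj (a m) / ((√‖a m‖ : ℝ) : ℂ)) (fun m => by
    rw [norm_div, RCLike.norm_conj, Complex.norm_real, Real.norm_of_nonneg (Real.sqrt_nonneg _),
      Real.div_sqrt]) hη⟩), fun x m => ?_⟩
  change ⟪(conj (a m) / ((√‖a m‖ : ℝ) : ℂ)) • η m, x (((√‖a m‖ : ℝ) : ℂ) • ξ m)⟫_ℂ = _
  rw [map_smul, inner_smul_left, inner_smul_right, ← mul_assoc]
  congr 1
  by_cases h0 : a m = 0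
  · simp [h0]
  · have : ((√‖a m‖ : ℝ) : ℂ) ≠ 0 := by
      rw [Complex.ofReal_ne_zero]
      exact (Real.sqrt_pos.2 (norm_pos_iff.2 h0)).ne'
    rw [map_div₀, Complex.conj_conj, Complex.conj_ofReal, div_mul_cancel₀ _ this]

/-- One step of the construction in the Krein–Šmulian theorem. -/
theorem exists_finset_polar {S : Submodule ℂ (H →L[ℂ] H)}
    (hS : ∀ (𝒰 : Ultrafilter (H →L[ℂ] H)) (T₀ : H →L[ℂ] H) (r : ℝ),
      (∀ᶠ T in (𝒰 : Filter (H →L[ℂ] H)), T ∈ S ∧ ‖T‖ ≤ r) → WTendsto id 𝒰 T₀ → T₀ ∈ S)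
    (x₀ : H →L[ℂ] H) {r r' : ℝ} (hr : 0 < r) (G : Finset (H × H))
    (hG : ∀ x ∈ S, ‖x - x₀‖ ≤ r → ∃ q ∈ G, 1 < ‖⟪q.1, (x - x₀) q.2⟫_ℂ‖) :
    ∃ G' : Finset (H × H), (∀ q ∈ G', ‖q.1‖ ≤ 1 ∧ ‖q.2‖ ≤ r⁻¹) ∧
      ∀ x ∈ S, ‖x - x₀‖ ≤ r' → ∃ q, (q ∈ G ∨ q ∈ G') ∧ 1 < ‖⟪q.1, (x - x₀) q.2⟫_ℂ‖ := by
  classical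
  by_contra! hcon
  -- The polar of these vector functionals is the ball of radius `r`. If every finite subset failed,
  -- a limit of the counterexamples over finite subsets would satisfy all the constraints, hence lie
  -- in that ball and contradict `hG`.
  let W := {q : H × H // ‖q.1‖ ≤ 1 ∧ ‖q.2‖ ≤ r⁻¹}
  have ex : ∀ g : Finset W, ∃ x ∈ S, ‖x - x₀‖ ≤ r' ∧
      (∀ q ∈ G, ‖⟪q.1, (x - x₀) q.2⟫_ℂ‖ ≤ 1) ∧
      ∀ q ∈ g, ‖⟪q.1.1, (x - x₀) q.1.2⟫_ℂ‖ ≤ 1 := fun g => by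
    obtain ⟨x, hx, hxr, h⟩ := hcon (g.map (Function.Embedding.subtype _)) (fun q hq => by
      obtain ⟨w, -, rfl⟩ := Finset.mem_map.1 hq
      exact w.2)
    exact ⟨x, hx, hxr, fun q hq => h q (Or.inl hq), fun q hq =>
      h q.1 (Or.inr (Finset.mem_map.2 ⟨q, hq, rfl⟩))⟩
  choose x hxS hxr hxG hxg using ex
  let 𝒰 : Ultrafilter (Finset W) := Ultrafilter.of atTop
  have h𝒰 : (𝒰 : Filter (Finset W)) ≤ atTop := Ultrafilter.of_le _
  have hb : ∀ g, ‖x g‖ ≤ r' + ‖x₀‖ := fun g => by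
    calc ‖x g‖ = ‖(x g - x₀) + x₀‖ := by rw [sub_add_cancel]
      _ ≤ _ := (norm_add_le _ _).trans (by gcongr; exact hxr g)
  obtain ⟨T₀, -, hT₀⟩ := exists_wTendsto 𝒰 x (Eventually.of_forall hb)
  have hT₀S : T₀ ∈ S := hS (𝒰.map x) T₀ (r' + ‖x₀‖)
    (by
      change ∀ᶠ g in (𝒰 : Filter (Finset W)), x g ∈ S ∧ ‖x g‖ ≤ r' + ‖x₀‖
      exact Eventually.of_forall fun g => ⟨hxS g, hb g⟩)
    (fun η ξ => tendsto_map'_iff.2 (hT₀ η ξ))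
  have hsub := hT₀.sub (wTendsto_const x₀ (𝒰 : Filter (Finset W)))
  have hTr : ‖T₀ - x₀‖ ≤ r := by
    refine ContinuousLinearMap.opNorm_le_of_re_inner_le hr.le fun ξ η hξ hη => ?_
    have h1 : ‖⟪η, (T₀ - x₀) (((r⁻¹ : ℝ) : ℂ) • ξ)⟫_ℂ‖ ≤ 1 := by
      let w : W := ⟨(η, ((r⁻¹ : ℝ) : ℂ) • ξ), hη.le, by
        rw [norm_smul, hξ, mul_one, Complex.norm_real, Real.norm_of_nonneg (by positivity)]⟩
      refine le_of_tendsto (hsub _ _).norm (h𝒰 ?_)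
      filter_upwards [eventually_ge_atTop {w}] with g hg
      exact hxg g w (hg (Finset.mem_singleton_self w))
    rw [map_smul, inner_smul_right, norm_mul, Complex.norm_real,
      Real.norm_of_nonneg (by positivity), inv_mul_le_iff₀ hr, mul_one, norm_inner_symm] at h1
    exact (RCLike.re_le_norm _).trans h1
  obtain ⟨q, hq, hq1⟩ := hG T₀ hT₀S hTr
  exact absurd hq1 (not_lt.2 (le_of_tendsto (hsub q.1 q.2).norm
    (Eventually.of_forall fun g => hxG g q hq)))

/-- **Krein–Šmulian**: a subspace of `B(H)` is weak* closed if it contains the weak limits of its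
bounded families. -/
theorem isWeakStarClosed_of_bounded {S : Submodule ℂ (H →L[ℂ] H)}
    (hS : ∀ (𝒰 : Ultrafilter (H →L[ℂ] H)) (T₀ : H →L[ℂ] H) (r : ℝ),
      (∀ᶠ T in (𝒰 : Filter (H →L[ℂ] H)), T ∈ S ∧ ‖T‖ ≤ r) → WTendsto id 𝒰 T₀ → T₀ ∈ S) :
    IsWeakStarClosed S := by
  classical
  have hclosed : IsClosed (S : Set (H →L[ℂ] H)) := by
    rw [isClosed_iff_ultrafilter]
    intro T₀ 𝒰 h𝒰 hSU
    refine hS 𝒰 T₀ (‖T₀‖ + 1) ?_ fun η ξ => ?_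
    · filter_upwards [hSU, h𝒰 (Metric.ball_mem_nhds T₀ one_pos)] with T hT hT'
      refine ⟨hT, ?_⟩
      rw [mem_ball_iff_norm] at hT'
      calc ‖T‖ = ‖(T - T₀) + T₀‖ := by rw [sub_add_cancel]
        _ ≤ _ := (norm_add_le _ _).trans (by linarith)
    · have : Continuous fun T : H →L[ℂ] H => ⟪η, T ξ⟫_ℂ := by fun_prop
      exact (this.tendsto T₀).mono_left h𝒰
  have sep : ∀ x₀ ∉ S, ∃ p : lp (fun _ : ℕ => H) 2 × lp (fun _ : ℕ => H) 2,
      (∀ x ∈ S, ∑' n, ⟪p.2 n, x (p.1 n)⟫_ℂ = 0) ∧ ∑' n, ⟪p.2 n, x₀ (p.1 n)⟫_ℂ ≠ 0 := by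
    intro x₀ hx₀
    obtain ⟨δ, hδ, hball⟩ := Metric.nhds_basis_closedBall.mem_iff.1
      (hclosed.isOpen_compl.mem_nhds hx₀)
    -- `G` separates `x₀` from the part of `S` within distance `δ(n + 1)`. At `n = 0` that part is
    -- empty, so `G = ∅` starts the induction.
    let Pr : ℕ → Finset (H × H) → Prop := fun n G => ∀ x ∈ S, ‖x - x₀‖ ≤ δ * (n + 1) →
      ∃ q ∈ G, 1 < ‖⟪q.1, (x - x₀) q.2⟫_ℂ‖
    have step : ∀ n G, Pr n G → ∃ G' : Finset (H × H),
        (∀ q ∈ G', ‖q.1‖ ≤ 1 ∧ ‖q.2‖ ≤ (δ * (n + 1))⁻¹) ∧ Pr (n + 1) (G ∪ G') :=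
        fun n G hG => by
      obtain ⟨G', h1, h2⟩ := exists_finset_polar hS x₀ (r' := δ * ((n + 1 : ℕ) + 1))
        (by positivity) G hG
      refine ⟨G', h1, fun x hx hxr => ?_⟩
      obtain ⟨q, hq, hq'⟩ := h2 x hx hxr
      exact ⟨q, Finset.mem_union.2 hq, hq'⟩
    choose! f hf hfP using step
    let G : ℕ → Finset (H × H) := fun n => Nat.rec ∅ (fun n G => G ∪ f n G) n
    have hG0 : G 0 = ∅ := rfl
    have hGs : ∀ n, G (n + 1) = G n ∪ f n (G n) := fun n => rfl
    have hGP : ∀ n, Pr n (G n) := fun n => by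
      induction n with
      | zero =>
        intro x hx hxr
        exact absurd hx (hball (by simpa [dist_eq_norm] using hxr))
      | succ n ih =>
        rw [hGs]
        exact hfP n _ ih
    -- The extra zero pair keeps every stage nonempty, so the total index set is infinite and can be
    -- enumerated by `ℕ`.
    let g : ℕ → Finset (H × H) := fun n => insert (0, 0) (f n (G n))
    have hg : ∀ n, ∀ q ∈ g n, ‖q.1‖ ≤ 1 ∧ ‖q.2‖ ≤ (δ * (n + 1))⁻¹ := fun n q hq => by
      rcases Finset.mem_insert.1 hq with rfl | hq
      · simp only [norm_zero, zero_le_one, true_and]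
        positivity
      · exact hf n _ (hGP n) q hq
    have hGg : ∀ n, ∀ q ∈ G n, ∃ k, q ∈ g k := fun n => by
      induction n with
      | zero => simp [hG0]
      | succ n ih =>
        intro q hq
        rcases Finset.mem_union.1 (hGs n ▸ hq) with hq | hq
        · exact ih q hq
        · exact ⟨n, Finset.mem_insert_of_mem hq⟩
    let I := Σ n, g n
    have : Infinite I := Infinite.of_injective
      (fun n => (⟨n, ⟨(0, 0), Finset.mem_insert_self _ _⟩⟩ : I)) fun n m h =>
        congrArg Sigma.fst h
    obtain ⟨e⟩ := nonempty_equiv_of_countable (α := ℕ) (β := I)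
    have hfst : Tendsto (Sigma.fst : I → ℕ) cofinite atTop := by
      rw [← Nat.cofinite_eq_atTop]
      refine Tendsto.cofinite_of_finite_preimage_singleton fun n => ?_
      refine (Set.finite_range fun q : g n => (⟨n, q⟩ : I)).subset ?_
      rintro ⟨m, q⟩ hm
      obtain rfl : m = n := hm
      exact ⟨q, rfl⟩
    have hlim : Tendsto (fun i : I => ‖i.2.1.2‖) cofinite (𝓝 0) := by
      refine squeeze_zero (fun _ => norm_nonneg _) (fun i => (hg i.1 _ i.2.2).2) ?_
      have h1 : Tendsto (fun n : ℕ => (δ * ((n : ℝ) + 1))⁻¹) atTop (𝓝 0) :=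
        tendsto_inv_atTop_zero.comp
          ((tendsto_natCast_atTop_atTop.atTop_add tendsto_const_nhds).const_mul_atTop hδ)
      exact h1.comp hfst
    have hη : ∀ m, ‖(e m).2.1.1‖ ≤ 1 := fun m => (hg _ _ (e m).2.2).1
    obtain ⟨a, ha, haS, ha0⟩ := exists_separating_sequence (S := S) (x₀ := x₀) hη
      (hlim.comp e.injective.tendsto_cofinite) (fun x hx => by
        obtain ⟨N, hN⟩ := exists_nat_ge (‖x - x₀‖ / δ)
        obtain ⟨q, hq, hq1⟩ := hGP N x hx (by
          rw [div_le_iff₀ hδ] at hN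
          nlinarith)
        obtain ⟨k, hk⟩ := hGg N q hq
        refine ⟨e.symm ⟨k, ⟨q, hk⟩⟩, ?_⟩
        rw [Equiv.apply_symm_apply]
        exact hq1)
    obtain ⟨p, hp⟩ := exists_lp_of_summable ha (C := max 1 δ⁻¹)
      (η := fun m => (e m).2.1.1) (ξ := fun m => (e m).2.1.2)
      (fun m => (hη m).trans (le_max_left _ _))
      (fun m => ((hg _ _ (e m).2.2).2.trans (by
        apply inv_anti₀ hδ
        have : (0 : ℝ) ≤ ((e m).1 : ℕ) := Nat.cast_nonneg _
        nlinarith)).trans (le_max_right _ _))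
    refine ⟨p, fun x hx => ?_, ?_⟩
    · simp only [hp]
      exact haS x hx
    · simp only [hp]
      exact ha0
  let _ := weakStar H
  change IsClosed (S : Set (H →L[ℂ] H))
  rw [isClosed_iff_ultrafilter]
  intro x₀ 𝒰 h𝒰 hSU
  by_contra hx₀
  obtain ⟨p, hp, hp0⟩ := sep x₀ hx₀
  refine hp0 (tendsto_nhds_unique ((tendsto_weakStar_iff (T := id)).1 h𝒰 p) ?_)
  refine tendsto_const_nhds.congr' ?_
  filter_upwards [hSU] with x hx
  exact (hp x hx).symm

end KreinSmulian

/-! ### Weak* continuity tested on bounded sets. -/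

section DualRepresentations

variable {H : Type u} [NormedAddCommGroup H] [InnerProductSpace ℂ H] [CompleteSpace H]
  {K : Type u} [NormedAddCommGroup K] [InnerProductSpace ℂ K] [CompleteSpace K]

/-- A map between spaces of operators that preserves weak limits of bounded families. -/
def BddWContinuous {F : Submodule ℂ (H →L[ℂ] H)} (f : F → K →L[ℂ] K) : Prop :=
  ∀ (𝒰 : Ultrafilter F) (x₀ : F) (r : ℝ), (∀ᶠ x in (𝒰 : Filter F), ‖x‖ ≤ r) →
    WTendsto (fun x : F => (x : H →L[ℂ] H)) 𝒰 x₀ → WTendsto f 𝒰 (f x₀)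

/-- The weak* functionals, as a linear map. -/
def weakStarEval (H : Type u) [NormedAddCommGroup H] [InnerProductSpace ℂ H] [CompleteSpace H] :
    (H →L[ℂ] H) →ₗ[ℂ] (lp (fun _ : ℕ => H) 2 × lp (fun _ : ℕ => H) 2 → ℂ) where
  toFun x p := ∑' n, ⟪p.2 n, x (p.1 n)⟫_ℂ
  map_add' x y := by
    ext p
    simp only [add_apply, inner_add_right, Pi.add_apply]
    exact (summable_inner_apply x p).tsum_add (summable_inner_apply y p)
  map_smul' c x := by
    ext p
    simp only [smul_apply, inner_smul_right, Pi.smul_apply, RingHom.id_apply, smul_eq_mul]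
    exact tsum_mul_left

theorem relWeakStar_eq (F : Submodule ℂ (H →L[ℂ] H)) :
    relWeakStar F = .induced (weakStarEval H ∘ₗ F.subtype) Pi.topologicalSpace :=
  induced_compose

theorem wTendsto_map {α β : Type*} {m : α → β} {l : Filter α} {T : β → H →L[ℂ] H}
    {T₀ : H →L[ℂ] H} : WTendsto T (map m l) T₀ ↔ WTendsto (T ∘ m) l T₀ :=
  forall₂_congr fun _ _ => tendsto_map'_iff

/-- Linear functionals that are continuous on bounded sets are weak* continuous. -/
theorem continuous_of_bounded {F : Submodule ℂ (H →L[ℂ] H)} (hF : IsWeakStarClosed F)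
    (f : F →ₗ[ℂ] ℂ)
    (hf : ∀ (𝒰 : Ultrafilter F) (x₀ : F) (r : ℝ), (∀ᶠ x in (𝒰 : Filter F), ‖x‖ ≤ r) →
      WTendsto (fun x : F => (x : H →L[ℂ] H)) 𝒰 x₀ → Tendsto f 𝒰 (𝓝 (f x₀))) :
    Continuous[relWeakStar F, inferInstance] f := by
  -- A linear functional is continuous as soon as its kernel is closed, and Krein–Šmulian reduces
  -- closedness of the kernel to bounded families.
  have hker : IsWeakStarClosed (f.ker.map F.subtype) := by
    refine isWeakStarClosed_of_bounded fun 𝒰 T₀ r hb hT => ?_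
    have hmem : ∀ᶠ T in (𝒰 : Filter (H →L[ℂ] H)), T ∈ F := by
      filter_upwards [hb] with T hT'
      obtain ⟨⟨x, -, rfl⟩, -⟩ := hT'
      exact x.2
    have hT₀ : T₀ ∈ F := hF.mem_of_wTendsto hT (hb.mono fun T h => h.2) hmem
    have hrange : Set.range (Subtype.val : F → H →L[ℂ] H) ∈ 𝒰 := by
      filter_upwards [hmem] with T h using ⟨⟨T, h⟩, rfl⟩
    let 𝒱 : Ultrafilter F := 𝒰.comap Subtype.val_injective hrange
    have h𝒱 : map Subtype.val (𝒱 : Filter F) = 𝒰 := by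
      rw [Ultrafilter.coe_comap]
      exact map_comap_of_mem hrange
    have hb' : ∀ᶠ x : F in (𝒱 : Filter F), (x : H →L[ℂ] H) ∈ f.ker.map F.subtype ∧ ‖x‖ ≤ r := by
      rw [← h𝒱] at hb
      exact hb
    have hlim := hf 𝒱 ⟨T₀, hT₀⟩ r (hb'.mono fun x h => h.2) (by
      rw [← h𝒱, wTendsto_map] at hT
      exact hT)
    have h0 : f ⟨T₀, hT₀⟩ = 0 := by
      refine tendsto_nhds_unique hlim (tendsto_const_nhds.congr' ?_)
      filter_upwards [hb'] with x hx
      obtain ⟨⟨y, hy, hyx⟩, -⟩ := hx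
      rw [← Subtype.ext hyx]
      exact hy.symm
    exact ⟨⟨T₀, hT₀⟩, h0, rfl⟩
  have h1 : @IsTopologicalAddGroup F (relWeakStar F) _ := by
    rw [relWeakStar_eq]
    exact topologicalAddGroup_induced _
  have h2 : @ContinuousSMul ℂ F _ _ (relWeakStar F) := by
    rw [relWeakStar_eq]
    exact continuousSMul_induced _
  let _ : TopologicalSpace F := relWeakStar F
  change Continuous f
  rw [LinearMap.continuous_iff_isClosed_ker]
  let _ : TopologicalSpace (H →L[ℂ] H) := weakStar H
  have h1 : IsClosed ((fun x : F => (x : H →L[ℂ] H)) ⁻¹' (f.ker.map F.subtype)) :=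
    IsClosed.preimage continuous_induced_dom hker
  convert h1 using 1
  ext x
  constructor
  · intro h
    exact ⟨x, h, rfl⟩
  · rintro ⟨y, hy, hyx⟩
    rw [← Subtype.ext hyx]
    exact hy

theorem isWeakStarContinuous_of_bounded {F : Submodule ℂ (H →L[ℂ] H)} (hF : IsWeakStarClosed F)
    {N : Submodule ℂ (K →L[ℂ] K)} (T : F →ₗ[ℂ] N) (hT1 : ∀ x, ‖T x‖ ≤ ‖x‖)
    (hT : BddWContinuous fun x => (T x : K →L[ℂ] K)) : IsWeakStarContinuous T := by
  rw [IsWeakStarContinuous, relWeakStar_eq N, continuous_induced_rng]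
  let _ : TopologicalSpace F := relWeakStar F
  refine continuous_pi fun p => ?_
  refine continuous_of_bounded hF
    ((LinearMap.proj p) ∘ₗ (weakStarEval K ∘ₗ N.subtype) ∘ₗ T) fun 𝒰 x₀ r hb h => ?_
  exact tendsto_weakStar_iff.1 ((hT 𝒰 x₀ r hb h).tendsto_weakStar
    (hb.mono fun x hx => (hT1 x).trans hx)) p

/-- An isometric representation that is weakly continuous on bounded sets is a weak*
homeomorphism onto a weak* closed subspace. -/
theorem weakStar_homeomorph {F : Submodule ℂ (H →L[ℂ] H)} (hF : IsWeakStarClosed F)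
    (N : Submodule ℂ (K →L[ℂ] K)) (π : F ≃ₗ[ℂ] N) (hiso : ∀ x, ‖π x‖ = ‖x‖)
    (hπ : BddWContinuous fun x => (π x : K →L[ℂ] K)) :
    IsWeakStarClosed N ∧ IsWeakStarContinuous π.toLinearMap ∧
      IsWeakStarContinuous π.symm.toLinearMap := by
  have hiso' : ∀ y, ‖π.symm y‖ = ‖y‖ := fun y => by rw [← hiso, π.apply_symm_apply]
  -- Bounded families in `N` are pulled back isometrically to `F`, where weak compactness provides a
  -- limit. This gives both closedness of `N` and continuity of the inverse.
  have key : ∀ (𝒱 : Ultrafilter N) (T₀ : K →L[ℂ] K) (r : ℝ), (∀ᶠ y in (𝒱 : Filter N), ‖y‖ ≤ r) →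
      WTendsto (fun y : N => (y : K →L[ℂ] K)) 𝒱 T₀ → ∃ x₀ : F, (π x₀ : K →L[ℂ] K) = T₀ ∧
        WTendsto (fun y : N => (π.symm y : H →L[ℂ] H)) 𝒱 x₀ := by
    intro 𝒱 T₀ r hb hT
    have hb' : ∀ᶠ y in (𝒱 : Filter N), ‖(π.symm y : H →L[ℂ] H)‖ ≤ r :=
      hb.mono fun y hy => (hiso' y).trans_le hy
    obtain ⟨x₀, -, hx₀⟩ := exists_wTendsto 𝒱 (fun y : N => (π.symm y : H →L[ℂ] H)) hb'
    have hmem : x₀ ∈ F := hF.mem_of_wTendsto hx₀ hb' (Eventually.of_forall fun y => (π.symm y).2)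
    refine ⟨⟨x₀, hmem⟩, ?_, hx₀⟩
    have h1 := hπ (𝒱.map π.symm) ⟨x₀, hmem⟩ r hb' (wTendsto_map.2 hx₀)
    rw [Ultrafilter.coe_map, wTendsto_map] at h1
    refine h1.unique ?_
    simpa [Function.comp_def] using hT
  have hN : IsWeakStarClosed N := by
    refine isWeakStarClosed_of_bounded fun 𝒰 T₀ r hb hT => ?_
    have hrange : Set.range (Subtype.val : N → K →L[ℂ] K) ∈ 𝒰 := by
      filter_upwards [hb] with T h using ⟨⟨T, h.1⟩, rfl⟩
    let 𝒱 : Ultrafilter N := 𝒰.comap Subtype.val_injective hrange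
    have h𝒱 : map Subtype.val (𝒱 : Filter N) = 𝒰 := by
      rw [Ultrafilter.coe_comap]
      exact map_comap_of_mem hrange
    rw [← h𝒱] at hb hT
    obtain ⟨x₀, hx₀, -⟩ := key 𝒱 T₀ r (Eventually.mono hb fun x h => h.2) (wTendsto_map.1 hT)
    rw [← hx₀]
    exact (π x₀).2
  refine ⟨hN, isWeakStarContinuous_of_bounded hF π.toLinearMap (fun x => (hiso x).le) hπ,
    isWeakStarContinuous_of_bounded hN π.symm.toLinearMap (fun y => (hiso' y).le) ?_⟩
  intro 𝒱 y₀ r hb hT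
  obtain ⟨x₀, hx₀, h⟩ := key 𝒱 y₀ r hb hT
  have : π.symm y₀ = x₀ := by rw [LinearEquiv.symm_apply_eq, Subtype.ext hx₀]
  change WTendsto (fun y : N => (π.symm y : H →L[ℂ] H)) 𝒱 (π.symm y₀)
  rw [this]
  exact h

end DualRepresentations

/-! ### Compressing a dilation to a weak* continuous representation. -/

section NormalRepresentation

variable {H : Type u} [NormedAddCommGroup H] [InnerProductSpace ℂ H] [CompleteSpace H]
  {K : Type u} [NormedAddCommGroup K] [InnerProductSpace ℂ K] [CompleteSpace K]

theorem norm_matOp_comp_le {n : ℕ} (a : Matrix (Fin n) (Fin n) (K →L[ℂ] K)) (A : K →L[ℂ] H)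
    (B : H →L[ℂ] K) (hA : ‖A‖ ≤ 1) (hB : ‖B‖ ≤ 1) :
    ‖matOp (a.map fun T => A ∘L T ∘L B)‖ ≤ ‖matOp a‖ := by
  rw [norm_matOp_le_iff _ (norm_nonneg _)]
  intro v
  have hA' : ∀ k, ‖A k‖ ≤ ‖k‖ := fun k => A.le_of_opNorm_le_of_le hA le_rfl |>.trans (one_mul _).le
  have hB' : ∀ k, ‖B k‖ ≤ ‖k‖ := fun k => B.le_of_opNorm_le_of_le hB le_rfl |>.trans (one_mul _).le
  calc ∑ i, ‖∑ j, (a.map fun T => A ∘L T ∘L B) i j (v j)‖ ^ 2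
      ≤ ∑ i, ‖∑ j, a i j (B (v j))‖ ^ 2 := by
        refine Finset.sum_le_sum fun i _ => ?_
        have : ∑ j, (a.map fun T => A ∘L T ∘L B) i j (v j) = A (∑ j, a i j (B (v j))) := by
          rw [map_sum]; rfl
        rw [this]
        gcongr
        exact hA' _
    _ ≤ ‖matOp a‖ ^ 2 * ∑ j, ‖B (v j)‖ ^ 2 :=
        (norm_matOp_le_iff a (norm_nonneg _)).1 le_rfl fun j => B (v j)
    _ ≤ ‖matOp a‖ ^ 2 * ∑ j, ‖v j‖ ^ 2 := by
        gcongr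
        exact hB' _

theorem norm_matOp_one (T : H →L[ℂ] H) :
    ‖matOp (Matrix.of fun _ _ : Fin 1 => T)‖ = ‖T‖ := by
  refine le_antisymm ?_ ?_
  · rw [norm_matOp_le_iff _ (norm_nonneg _)]
    intro v
    simp only [Finset.univ_unique, Finset.sum_singleton, Matrix.of_apply]
    rw [← mul_pow]
    gcongr
    exact T.le_opNorm _
  · refine T.opNorm_le_bound (norm_nonneg _) fun ξ => ?_
    have := (norm_matOp_le_iff (Matrix.of fun _ _ : Fin 1 => T) (norm_nonneg _)).1 le_rfl fun _ => ξ
    simp only [Finset.univ_unique, Finset.sum_singleton, Matrix.of_apply] at this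
    rw [← mul_pow] at this
    exact le_of_sq_le_sq this (by positivity)

/-- The hypothesis says `V* τ(x) V = x`, and compressing by a contraction does not increase matrix
norms. For a completely contractive `τ` this yields complete isometry. -/
theorem norm_subMatOp_le_of_compression {F : Submodule ℂ (H →L[ℂ] H)} (τ : F →ₗ[ℂ] (K →L[ℂ] K))
    {V : H →L[ℂ] K} (hV : ‖V‖ ≤ 1) (hτ : ∀ x η ξ, ⟪V η, τ x (V ξ)⟫_ℂ = ⟪η, (x : H →L[ℂ] H) ξ⟫_ℂ)
    {n : ℕ} (a : Matrix (Fin n) (Fin n) F) : ‖subMatOp F a‖ ≤ ‖matOp (a.map τ)‖ := by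
  have h := norm_matOp_comp_le (a.map τ) (ContinuousLinearMap.adjoint V) V
    ((LinearIsometryEquiv.norm_map _ _).trans_le hV) hV
  refine le_of_eq_of_le ?_ h
  rw [subMatOp]
  congr 2
  ext i j ξ
  refine ext_inner_left ℂ fun η => ?_
  simp only [Matrix.map_apply, ContinuousLinearMap.comp_apply,
    ContinuousLinearMap.adjoint_inner_right, hτ]

theorem inner_eq_zero_of_mem_closure_span {A B : Set K} {T : K →L[ℂ] K}
    (h : ∀ a ∈ A, ∀ b ∈ B, ⟪b, T a⟫_ℂ = 0) {a b : K}
    (ha : a ∈ (Submodule.span ℂ A).topologicalClosure)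
    (hb : b ∈ (Submodule.span ℂ B).topologicalClosure) : ⟪b, T a⟫_ℂ = 0 := by
  have h1 : (Submodule.span ℂ A).topologicalClosure ≤
      ((Submodule.span ℂ B)ᗮ).comap (T : K →ₗ[ℂ] K) := by
    refine Submodule.topologicalClosure_minimal _ ?_
      (IsClosed.preimage T.continuous (Submodule.isClosed_orthogonal _))
    rw [Submodule.span_le]
    intro a ha
    have : Submodule.span ℂ B ≤ (ℂ ∙ T a)ᗮ := by
      rw [Submodule.span_le]
      intro b hb
      rw [SetLike.mem_coe, Submodule.mem_orthogonal_singleton_iff_inner_left]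
      exact h a ha b hb
    change T a ∈ (Submodule.span ℂ B)ᗮ
    intro b hb
    exact Submodule.mem_orthogonal_singleton_iff_inner_left.1 (this hb)
  have h2 : T a ∈ (Submodule.span ℂ B)ᗮ := h1 ha
  rw [← Submodule.orthogonal_closure] at h2
  exact h2 b hb

theorem mem_closure_span_of_forall {A : Set K} {L : Submodule ℂ K} (hL : IsClosed (L : Set K))
    {T : K →L[ℂ] K} (h : ∀ a ∈ A, T a ∈ L) {a : K}
    (ha : a ∈ (Submodule.span ℂ A).topologicalClosure) : T a ∈ L :=
  (Submodule.topologicalClosure_minimal (t := L.comap (T : K →ₗ[ℂ] K)) _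
    (Submodule.span_le.2 h) (IsClosed.preimage T.continuous hL)) ha

/-- A multiplicative dilation of a separately weak* continuous product has a compression to a
semi-invariant subspace that is still multiplicative and moreover weak* continuous on bounded
sets. -/
theorem exists_normal_representation {F : Submodule ℂ (H →L[ℂ] H)} (τ : F →ₗ[ℂ] (K →L[ℂ] K))
    (hcc : ∀ (n : ℕ) (a : Matrix (Fin n) (Fin n) F), ‖matOp (a.map τ)‖ ≤ ‖subMatOp F a‖)
    {V : H →L[ℂ] K} (hV : ‖V‖ ≤ 1) (hτ : ∀ x η ξ, ⟪V η, τ x (V ξ)⟫_ℂ = ⟪η, (x : H →L[ℂ] H) ξ⟫_ℂ)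
    (m : F → F → F) (hm : ∀ x y, τ x * τ y = τ (m x y)) {e : F} (he : τ e = 1)
    (hl : ∀ a, BddWContinuous fun x => (m a x : H →L[ℂ] H))
    (hr : ∀ a, BddWContinuous fun x => (m x a : H →L[ℂ] H)) :
    ∃ (L : Type u) (_ : NormedAddCommGroup L) (_ : InnerProductSpace ℂ L) (_ : CompleteSpace L)
      (π : F →ₗ[ℂ] (L →L[ℂ] L)),
      (∀ (n : ℕ) (a : Matrix (Fin n) (Fin n) F), ‖matOp (a.map π)‖ = ‖subMatOp F a‖) ∧
      (BddWContinuous fun x => π x) ∧ (∀ x y, π x * π y = π (m x y)) ∧ π e = 1 := by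
  have hm' : ∀ x y k, τ x (τ y k) = τ (m x y) k := fun x y k => by rw [← hm]; rfl
  have hnorm : ∀ x, ‖τ x‖ = ‖x‖ := fun x => by
    have h1 := hcc 1 (Matrix.of fun _ _ => x)
    have h2 := norm_subMatOp_le_of_compression τ hV hτ (Matrix.of fun _ _ : Fin 1 => x)
    rw [← norm_matOp_one]
    refine (le_antisymm h1 h2).trans ?_
    exact norm_matOp_one (x : H →L[ℂ] H)
  have hmn : ∀ x y, ‖m x y‖ ≤ ‖x‖ * ‖y‖ := fun x y => by
    rw [← hnorm, ← hnorm x, ← hnorm y, ← hm]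
    exact norm_mul_le _ _
  -- The closed span `K₁` is invariant under all `τ(x)*`, so `p τ(x) p = p τ(x)` and compression to
  -- `K₁` is multiplicative.
  let A : Set K := {k | ∃ b η, k = ContinuousLinearMap.adjoint (τ b) (V η)}
  let K₁ : Submodule ℂ K := (Submodule.span ℂ A).topologicalClosure
  have hK₁ : IsClosed (K₁ : Set K) := Submodule.isClosed_topologicalClosure _
  have : CompleteSpace K₁ := hK₁.completeSpace_coe
  let p : K →L[ℂ] K := K₁.starProjection
  have hpinner : ∀ l ∈ K₁, ∀ k, ⟪l, p k⟫_ℂ = ⟪l, k⟫_ℂ := fun l hl k => by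
    rw [← Submodule.inner_starProjection_left_eq_right, Submodule.starProjection_eq_self_iff.2 hl]
  have hinv : ∀ x, ∀ l ∈ K₁, ContinuousLinearMap.adjoint (τ x) l ∈ K₁ := by
    intro x l hl
    refine mem_closure_span_of_forall hK₁ ?_ hl
    rintro _ ⟨b, η, rfl⟩
    refine Submodule.le_topologicalClosure _ (Submodule.subset_span ⟨m b x, η, ?_⟩)
    refine ext_inner_left ℂ fun k => ?_
    simp only [ContinuousLinearMap.adjoint_inner_right, hm']
  have hsemi : ∀ x k, p (τ x (p k)) = p (τ x k) := by
    intro x k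
    refine ext_inner_left ℂ fun l => ?_
    have h1 : ∀ k', ⟪l, p k'⟫_ℂ = ⟪p l, k'⟫_ℂ := fun k' =>
      (Submodule.inner_starProjection_left_eq_right _ _ _).symm
    have h2 : p l ∈ K₁ := Submodule.starProjection_apply_mem _ _
    rw [h1, h1, ← ContinuousLinearMap.adjoint_inner_left (τ x), hpinner _ (hinv x _ h2),
      ContinuousLinearMap.adjoint_inner_left]
  -- The closed span `K₂` is invariant under the compressed operators `p τ(x)`, so restricting to it
  -- stays multiplicative; it still contains the range of `V`, so complete isometry survives.
  let B : Set K := {k | ∃ a ξ, k = p (τ a (V ξ))}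
  let K₂ : Submodule ℂ K := (Submodule.span ℂ B).topologicalClosure
  have hK₂ : IsClosed (K₂ : Set K) := Submodule.isClosed_topologicalClosure _
  have : CompleteSpace K₂ := hK₂.completeSpace_coe
  have hle : K₂ ≤ K₁ := by
    refine Submodule.topologicalClosure_minimal _ (Submodule.span_le.2 ?_) hK₁
    rintro _ ⟨a, ξ, rfl⟩
    exact Submodule.starProjection_apply_mem _ _
  have hinv₂ : ∀ x, ∀ k ∈ K₂, p (τ x k) ∈ K₂ := by
    intro x k hk
    refine mem_closure_span_of_forall (T := p ∘L τ x) hK₂ ?_ hk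
    rintro _ ⟨a, ξ, rfl⟩
    refine Submodule.le_topologicalClosure _ (Submodule.subset_span ⟨m x a, ξ, ?_⟩)
    rw [ContinuousLinearMap.comp_apply, hsemi, hm']
  have hVmem : ∀ ξ, V ξ ∈ K₂ := by
    intro ξ
    refine Submodule.le_topologicalClosure _ (Submodule.subset_span ⟨e, ξ, ?_⟩)
    have : V ξ ∈ K₁ := Submodule.le_topologicalClosure _ (Submodule.subset_span ⟨e, ξ, by
      refine ext_inner_left ℂ fun k => ?_
      rw [ContinuousLinearMap.adjoint_inner_right, he]; rfl⟩)
    rw [he]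
    exact (Submodule.starProjection_eq_self_iff.2 this).symm
  let q : K →L[ℂ] K₂ := K₂.orthogonalProjectionOnto
  have hq : ∀ (l : K₂) (k : K), ⟪l, q k⟫_ℂ = ⟪(l : K), k⟫_ℂ := fun l k =>
    Submodule.inner_orthogonalProjectionOnto_eq_of_mem_left _ _
  let π : F →ₗ[ℂ] (K₂ →L[ℂ] K₂) :=
    { toFun := fun x => q ∘L τ x ∘L K₂.subtypeL
      map_add' := fun x y => by ext k; simp
      map_smul' := fun c x => by ext k; simp }
  have hπinner : ∀ x (l k : K₂), ⟪l, π x k⟫_ℂ = ⟪(l : K), τ x k⟫_ℂ := fun x l k => hq _ _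
  have hπ : ∀ x (k : K₂), (π x k : K) = p (τ x k) := by
    intro x k
    have : π x k = ⟨p (τ x k), hinv₂ x k k.2⟩ := by
      refine ext_inner_left ℂ fun l => ?_
      rw [hπinner, Submodule.coe_inner, hpinner _ (hle l.2)]
    rw [this]
  let V₂ : H →L[ℂ] K₂ := V.codRestrict K₂ hVmem
  have hV₂ : ‖V₂‖ ≤ 1 := V₂.opNorm_le_bound zero_le_one fun ξ => V.le_of_opNorm_le hV ξ
  refine ⟨K₂, inferInstance, inferInstance, inferInstance, π, fun n a => le_antisymm ?_ ?_,
    ?_, ?_, ?_⟩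
  · refine le_trans ?_ (hcc n a)
    exact norm_matOp_comp_le (a.map τ) q K₂.subtypeL (Submodule.orthogonalProjectionOnto_norm_le _)
      (Submodule.norm_subtypeL_le _)
  · exact norm_subMatOp_le_of_compression π hV₂ (fun x η ξ => (hπinner _ _ _).trans (hτ x η ξ)) a
  · intro 𝒰 x₀ r hb hx
    have hb' : ∀ᶠ x in (𝒰 : Filter F), ‖τ x‖ ≤ r := hb.mono fun x h => (hnorm x).trans_le h
    obtain ⟨S, -, hS⟩ := exists_wTendsto 𝒰 (fun x => τ x) hb'
    have key : ∀ k ∈ K₂, ∀ l ∈ K₁, ⟪l, (S - τ x₀) k⟫_ℂ = 0 := by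
      intro k hk l hl'
      refine inner_eq_zero_of_mem_closure_span ?_ hk hl'
      rintro _ ⟨a, ξ, rfl⟩ _ ⟨b, η, rfl⟩
      -- On generators of `K₁` and `K₂` the coefficients of `τ(x)` reduce to the product `b x a` in
      -- `F`, where separate continuity applies, first on the right and then on the left.
      have hform : ∀ x, ⟪ContinuousLinearMap.adjoint (τ b) (V η), τ x (p (τ a (V ξ)))⟫_ℂ =
          ⟪η, (m b (m x a) : H →L[ℂ] H) ξ⟫_ℂ := by
        intro x
        have h1 : ContinuousLinearMap.adjoint (τ b) (V η) ∈ K₁ :=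
          Submodule.le_topologicalClosure _ (Submodule.subset_span ⟨b, η, rfl⟩)
        rw [← hpinner _ h1, hsemi, hpinner _ h1, ContinuousLinearMap.adjoint_inner_left, hm' x,
          hm' b, hτ]
      have h2 := hS (ContinuousLinearMap.adjoint (τ b) (V η)) (p (τ a (V ξ)))
      simp only [hform] at h2
      have h3 := hr a 𝒰 x₀ r hb hx
      have hb₁ : ∀ᶠ x in (𝒰 : Filter F), ‖m x a‖ ≤ r * ‖a‖ := hb.mono fun x h =>
        (hmn x a).trans (by gcongr)
      have h4 := hl b (𝒰.map fun x => m x a) (m x₀ a) (r * ‖a‖)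
        hb₁ (wTendsto_map.2 h3)
      rw [Ultrafilter.coe_map, wTendsto_map] at h4
      rw [sub_apply, inner_sub_right, hform, sub_eq_zero]
      exact tendsto_nhds_unique h2 (h4 η ξ)
    intro l k
    have h5 := key k k.2 l (hle l.2)
    rw [sub_apply, inner_sub_right, sub_eq_zero] at h5
    simp only [hπinner]
    rw [← h5]
    exact hS l k
  · intro x y
    ext k
    rw [mul_apply_eq_comp, hπ, hπ, hπ, hsemi, hm']
  · ext k
    rw [hπ, he]
    exact Submodule.starProjection_eq_self_iff.2 (hle k.2)

end NormalRepresentation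

/-! ### The new product on the range of the projection. -/

section ChoiEffros

variable {H : Type u} [NormedAddCommGroup H] [InnerProductSpace ℂ H] [CompleteSpace H]

/-- For `v = eξ` one has `⟪e*v, v⟫ = ‖v‖²` and `‖e*v‖ ≤ ‖v‖`, so expanding `‖e*v - v‖²` gives `e*v =
v`. Thus `e = e*e` is self-adjoint. -/
theorem star_eq_of_mul_self {e : H →L[ℂ] H} (he : e * e = e) (hn : ‖e‖ ≤ 1) : star e = e := by
  have h : star e * e = e := by
    ext ξ
    have hv : e (e ξ) = e ξ := congrArg (fun T : H →L[ℂ] H => T ξ) he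
    have h1 : ‖star e (e ξ)‖ ≤ ‖e ξ‖ := by
      simpa using (star e).le_of_opNorm_le ((norm_star e).trans_le hn) (e ξ)
    have h2 : ⟪star e (e ξ), e ξ⟫_ℂ = ⟪e ξ, e ξ⟫_ℂ := by
      rw [ContinuousLinearMap.star_eq_adjoint, ContinuousLinearMap.adjoint_inner_left, hv]
    have h3 := norm_sub_sq (𝕜 := ℂ) (star e (e ξ)) (e ξ)
    rw [h2, inner_self_eq_norm_sq (𝕜 := ℂ)] at h3
    have h4 : ‖star e (e ξ) - e ξ‖ = 0 := by
      have : ‖star e (e ξ)‖ ^ 2 ≤ ‖e ξ‖ ^ 2 := by gcongr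
      have := sq_nonneg ‖star e (e ξ) - e ξ‖
      exact pow_eq_zero_iff two_ne_zero |>.1 (by linarith)
    exact sub_eq_zero.1 (norm_eq_zero.1 h4)
  rw [← h, star_mul, star_star]

/-- Multiplying `ex + xe = 2x` by the idempotent `e` on the left and on the right gives `ex = exe =
xe`. This lets the Jordan case use the same extension argument as the associative one. -/
theorem mul_eq_of_jordanMul_eq {e x : H →L[ℂ] H} (he : jordanMul e e = e)
    (hx : jordanMul e x = x) : e * x = x ∧ x * e = x := by
  have he' : e * e = e := by
    rw [jordanMul, ← two_smul ℂ (e * e), smul_smul] at he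
    simpa using he
  have hx' : e * x + x * e = (2 : ℂ) • x := by
    conv_rhs => rw [← hx, jordanMul, smul_smul]
    simp
  have h1 : e * x + e * x * e = (2 : ℂ) • (e * x) := by
    have := congrArg (e * ·) hx'
    simpa only [mul_add, ← mul_assoc, he', mul_smul_comm] using this
  have h2 : e * x * e + x * e = (2 : ℂ) • (x * e) := by
    have := congrArg (· * e) hx'
    simpa only [add_mul, mul_assoc, he', smul_mul_assoc] using this
  rw [two_smul] at h1 h2 hx'
  have h3 : e * x * e = e * x := add_left_cancel h1
  have h4 : e * x * e = x * e := add_right_cancel h2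
  have h5 : e * x = x * e := h3.symm.trans h4
  rw [← h5, ← two_smul ℂ, ← two_smul ℂ] at hx'
  have h6 : e * x = x := smul_right_injective _ (two_ne_zero (α := ℂ)) hx'
  exact ⟨h6, h5 ▸ h6⟩

theorem IsWeakStarClosed.isClosed {S : Submodule ℂ (H →L[ℂ] H)} (hS : IsWeakStarClosed S) :
    IsClosed (S : Set (H →L[ℂ] H)) := by
  refine isClosed_of_closure_subset fun T hT => ?_
  have : (𝓝[(S : Set (H →L[ℂ] H))] T).NeBot := mem_closure_iff_nhdsWithin_neBot.1 hT
  have hid : Tendsto (fun T : H →L[ℂ] H => T) (𝓝[(S : Set (H →L[ℂ] H))] T) (𝓝 T) :=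
    tendsto_id.mono_left nhdsWithin_le_nhds
  refine hS.mem_of_wTendsto (T := fun T => T) (l := 𝓝[(S : Set (H →L[ℂ] H))] T) (C := ‖T‖ + 1)
    (fun η ξ => ?_) ?_ self_mem_nhdsWithin
  · exact tendsto_const_nhds.inner (((ContinuousLinearMap.apply ℂ H ξ).continuous.tendsto T).comp
      hid)
  · filter_upwards [hid.norm.eventually_lt_const (lt_add_one ‖T‖)] with T h using h.le

variable {Q : (H →L[ℂ] H) →ₗ[ℂ] (H →L[ℂ] H)} {F : Submodule ℂ (H →L[ℂ] H)}

/-- The product `(x, y) ↦ Q (x * y)` is weakly continuous on bounded sets in the second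
variable. -/
theorem IsRCP.bddWContinuous_mul_left (hQ : IsRCP Q) (h1 : ‖Q 1‖ ≤ 1) (hid : ∀ b, Q (Q b) = Q b)
    (hF : IsWeakStarClosed F) (hQF : ∀ x ∈ F, Q x = x) {m : F → F → F}
    (hm : ∀ x y : F, (m x y : H →L[ℂ] H) = Q (x * y)) (a : F) :
    BddWContinuous fun x => (m a x : H →L[ℂ] H) := by
  intro 𝒰 x₀ r hb hx
  have hb' : ∀ᶠ x in (𝒰 : Filter F), ‖(m a x : H →L[ℂ] H)‖ ≤ ‖a‖ * r := by
    filter_upwards [hb] with x h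
    rw [hm]
    exact (hQ.norm_map_le h1 _).trans ((norm_mul_le _ _).trans
      (mul_le_mul_of_nonneg_left h (norm_nonneg _)))
  obtain ⟨z, -, hz⟩ := exists_wTendsto 𝒰 (fun x => (m a x : H →L[ℂ] H)) hb'
  have hzF : z ∈ F := hF.mem_of_wTendsto hz hb' (Eventually.of_forall fun x => (m a x).2)
  have h := hQ.map_eq_of_wTendsto h1 hid (hQF a a.2) 𝒰 (y := fun x => (x : H →L[ℂ] H)) hb
    (y₀ := x₀) (z := z) (by simpa only [hQF _ (Subtype.prop _)] using hx)
    (by simpa only [hm] using hz)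
  rw [hQF z hzF] at h
  change WTendsto (fun x => (m a x : H →L[ℂ] H)) 𝒰 (m a x₀)
  rw [hm a x₀, ← h]
  exact hz

theorem IsRCP.bddWContinuous_mul_right (hQ : IsRCP Q) (h1 : ‖Q 1‖ ≤ 1)
    (hid : ∀ b, Q (Q b) = Q b) (hF : IsWeakStarClosed F) (hQF : ∀ x ∈ F, Q x = x)
    {m : F → F → F} (hm : ∀ x y : F, (m x y : H →L[ℂ] H) = Q (x * y)) (a : F) :
    BddWContinuous fun x => (m x a : H →L[ℂ] H) := by
  intro 𝒰 x₀ r hb hx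
  have hb' : ∀ᶠ x in (𝒰 : Filter F), ‖(m x a : H →L[ℂ] H)‖ ≤ r * ‖a‖ := by
    filter_upwards [hb] with x h
    rw [hm]
    exact (hQ.norm_map_le h1 _).trans ((norm_mul_le _ _).trans
      (mul_le_mul_of_nonneg_right h (norm_nonneg _)))
  obtain ⟨z, -, hz⟩ := exists_wTendsto 𝒰 (fun x => (m x a : H →L[ℂ] H)) hb'
  have hzF : z ∈ F := hF.mem_of_wTendsto hz hb' (Eventually.of_forall fun x => (m x a).2)
  -- Adjoints of elements of `F` need not lie in `F`, but `Q` fixes them, so the limit identity can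
  -- be applied to the adjoint family.
  have hQs : ∀ x ∈ F, Q (star x) = star x := fun x hx => by rw [hQ.map_star, hQF x hx]
  have h := hQ.map_eq_of_wTendsto h1 hid (hQs a a.2) 𝒰 (y := fun x => star (x : H →L[ℂ] H))
    (C := r) (by simp only [norm_star]; exact hb)
    (y₀ := star (x₀ : H →L[ℂ] H)) (z := star z)
    (by simpa only [hQs _ (Subtype.prop _)] using hx.adjoint)
    (by simpa only [hm, ← hQ.map_star, star_mul] using hz.adjoint)
  rw [← star_mul, hQ.map_star, hQ.map_star, star_inj, hQF z hzF] at h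
  change WTendsto (fun x => (m x a : H →L[ℂ] H)) 𝒰 (m x₀ a)
  rw [hm x₀ a, ← h]
  exact hz

variable {M : Submodule ℂ (H →L[ℂ] H)} {P : M →ₗ[ℂ] M}

theorem IsCompletelyContractive.norm_map_le (hP : IsCompletelyContractive P) (x : M) :
    ‖P x‖ ≤ ‖x‖ :=
  (norm_matOp_one (P x : H →L[ℂ] H)).symm.trans_le
    ((hP 1 (Matrix.of fun _ _ => x)).trans (norm_matOp_one (x : H →L[ℂ] H)).le)

/-- The range of a completely contractive real completely positive projection, with the
product induced by an idempotent extension `Q` of the projection to `B(H)`, has a completely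
isometric multiplicative dilation. -/
theorem exists_dilation_of_projection (hP : IsRealCompletelyPositive P) (hPP : P ∘ₗ P = P)
    (hPc : IsCompletelyContractive P) {e : H →L[ℂ] H} (he : e ∈ M) (hen : ‖e‖ ≤ 1)
    (hunit : ∀ x ∈ M, e * x = x ∧ x * e = x) :
    ∃ Q : (H →L[ℂ] H) →ₗ[ℂ] (H →L[ℂ] H), IsRCP Q ∧ ‖Q 1‖ ≤ 1 ∧ (∀ b, Q (Q b) = Q b) ∧
      (∀ x : M, Q x = P x) ∧ (∀ x ∈ rangeSpace P, Q x = x) ∧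
      ∃ (K : Type u) (_ : NormedAddCommGroup K) (_ : InnerProductSpace ℂ K) (_ : CompleteSpace K)
        (τ : rangeSpace P →ₗ[ℂ] (K →L[ℂ] K)) (V : H →L[ℂ] K),
        (∀ (n : ℕ) (a : Matrix (Fin n) (Fin n) (rangeSpace P)),
          ‖matOp (a.map τ)‖ ≤ ‖subMatOp (rangeSpace P) a‖) ∧
        ‖V‖ ≤ 1 ∧ (∀ x η ξ, ⟪V η, τ x (V ξ)⟫_ℂ = ⟪η, (x : H →L[ℂ] H) ξ⟫_ℂ) ∧
        (∀ x y z : rangeSpace P, Q (x * y + y * x) = (2 : ℂ) • (z : H →L[ℂ] H) →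
          τ x * τ y + τ y * τ x = (2 : ℂ) • τ z) ∧
        (∀ x y z : rangeSpace P, Q (x * y) = z → τ x * τ y = τ z) ∧ ∃ u, τ u = 1 := by
  have hes : star e = e := star_eq_of_mul_self (hunit e he).1 hen
  have hPe : ‖P ⟨e, he⟩‖ ≤ 1 := (hPc.norm_map_le _).trans hen
  obtain ⟨Q, hQ, hid, hQP, hQ1⟩ := exists_idempotent_isRCP_extension hP hPP he hes hunit hPe
  have h1 : ‖Q 1‖ ≤ 1 := by rw [hQ1]; exact hPe
  have hQF : ∀ x ∈ rangeSpace P, Q x = x := by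
    rintro _ ⟨x, rfl⟩
    change Q (P x : H →L[ℂ] H) = P x
    rw [← hQP, hid]
  have hle : rangeSpace P ≤ LinearMap.range Q := fun x hx => ⟨x, hQF x hx⟩
  obtain ⟨K, i₁, i₂, i₃, σ, V, hcc, hV, hσV, hσm, hσ1⟩ := exists_dilation hQ h1 hid
  refine ⟨Q, hQ, h1, hid, hQP, hQF, K, i₁, i₂, i₃, σ ∘ₗ Submodule.inclusion hle, V, fun n a => ?_,
    hV, fun x η ξ => hσV _ _ _, fun x y z hxy => ?_, fun x y z hxy => hσm _ _ _ hxy,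
    ⟨P ⟨e, he⟩, ⟨_, rfl⟩⟩, hσ1 _ hQ1⟩
  · exact hcc n (a.map (Submodule.inclusion hle))
  · have hx := hσm (Submodule.inclusion hle x) (Submodule.inclusion hle y) ⟨_, _, rfl⟩ rfl
    have hy := hσm (Submodule.inclusion hle y) (Submodule.inclusion hle x) ⟨_, _, rfl⟩ rfl
    simp only [LinearMap.comp_apply]
    rw [hx, hy, ← map_add, ← map_smul]
    congr 1
    exact Subtype.ext ((map_add Q _ _).symm.trans hxy)

theorem isCompletelyIsometric_ofInjective {K : Type u} [NormedAddCommGroup K]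
    [InnerProductSpace ℂ K] [CompleteSpace K] {τ : F →ₗ[ℂ] (K →L[ℂ] K)}
    (hτ : Function.Injective τ)
    (hiso : ∀ (n : ℕ) (a : Matrix (Fin n) (Fin n) F), ‖matOp (a.map τ)‖ = ‖subMatOp F a‖) :
    IsCompletelyIsometric (LinearEquiv.ofInjective τ hτ).toLinearMap :=
  fun n a => hiso n a

theorem norm_eq_of_norm_matOp_eq {K : Type u} [NormedAddCommGroup K]
    [InnerProductSpace ℂ K] [CompleteSpace K] {τ : F →ₗ[ℂ] (K →L[ℂ] K)}
    (hiso : ∀ (n : ℕ) (a : Matrix (Fin n) (Fin n) F), ‖matOp (a.map τ)‖ = ‖subMatOp F a‖)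
    (x : F) : ‖τ x‖ = ‖x‖ :=
  (norm_matOp_one (τ x)).symm.trans
    ((hiso 1 (Matrix.of fun _ _ => x)).trans (norm_matOp_one (x : H →L[ℂ] H)))

theorem isClosed_range_of_norm_eq {K : Type u} [NormedAddCommGroup K]
    [InnerProductSpace ℂ K] [CompleteSpace K] (hF : IsWeakStarClosed F)
    {τ : F →ₗ[ℂ] (K →L[ℂ] K)} (hτ : ∀ x, ‖τ x‖ = ‖x‖) :
    IsClosed (LinearMap.range τ : Set (K →L[ℂ] K)) := by
  have : CompleteSpace F := hF.isClosed.completeSpace_coe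
  rw [LinearMap.coe_range]
  exact (AddMonoidHomClass.isometry_of_norm τ hτ).isClosedEmbedding.isClosed_range

/-- For `x`, `y` in the range, `P(xy) = Q(xy)` because `xy ∈ M`. Separate continuity of this product
feeds `exists_normal_representation`, and `weakStar_homeomorph` handles the topology. -/
theorem isUnitalDualOperatorAlgebraWith_newMul (hM : IsUnitalOperatorAlgebra M)
    (hP : IsRealCompletelyPositive P) (hPP : P ∘ₗ P = P) (hPc : IsCompletelyContractive P)
    (hF : IsWeakStarClosed (rangeSpace P)) :
    IsUnitalDualOperatorAlgebraWith (rangeSpace P) (newMul hM P) := by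
  obtain ⟨e, he, hen, hunit⟩ := hM.exists_unit
  obtain ⟨Q, hQ, h1, hid, hQP, hQF, K, _, _, _, τ, V, hcc, hV, hτV, -, hτm, u, hu⟩ :=
    exists_dilation_of_projection hP hPP hPc he hen hunit
  have hm : ∀ x y : rangeSpace P, (newMul hM P x y : H →L[ℂ] H) = Q (x * y) := fun x y =>
    (hQP _).symm
  obtain ⟨L, i₁, i₂, i₃, π, hiso, hπc, hπm, hπ1⟩ := exists_normal_representation τ hcc hV hτV
    (newMul hM P) (fun x y => hτm x y _ (hm x y).symm) hu
    (hQ.bddWContinuous_mul_left h1 hid hF hQF hm) (hQ.bddWContinuous_mul_right h1 hid hF hQF hm)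
  have hnorm := norm_eq_of_norm_matOp_eq hiso
  have hinj : Function.Injective π := (AddMonoidHomClass.isometry_of_norm π hnorm).injective
  obtain ⟨hN, hc, hc'⟩ := weakStar_homeomorph hF _ (LinearEquiv.ofInjective π hinj) hnorm hπc
  refine ⟨hF, L, i₁, i₂, i₃, LinearMap.range π, LinearEquiv.ofInjective π hinj,
    ⟨isClosed_range_of_norm_eq hF hnorm, ?_, π u, ⟨u, rfl⟩, ?_, ?_⟩, hN,
    isCompletelyIsometric_ofInjective hinj hiso, hc, hc', fun x y => (hπm x y).symm⟩
  · rintro _ ⟨x, rfl⟩ _ ⟨y, rfl⟩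
    exact ⟨_, (hπm x y).symm⟩
  · rw [hπ1]
    exact ContinuousLinearMap.norm_id_le
  · intro x _
    rw [hπ1]
    exact ⟨one_mul x, mul_one x⟩

/-- Individual products `xy` may leave `M`, and `Q(xy)` may leave the range of `P`; only the
symmetrised product is known to return. No weak* continuity is claimed, so the dilation is used
without further compression. -/
theorem isUnitalJordanOperatorAlgebraWith_newJordanMul (hM : IsUnitalJordanOperatorAlgebra M)
    (hP : IsRealCompletelyPositive P) (hPP : P ∘ₗ P = P) (hPc : IsCompletelyContractive P)
    (hF : IsWeakStarClosed (rangeSpace P)) :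
    IsUnitalJordanOperatorAlgebraWith (rangeSpace P) (newJordanMul hM P) := by
  obtain ⟨e, he, hen, hunit⟩ := hM.exists_unit
  obtain ⟨Q, hQ, h1, hid, hQP, hQF, K, i₁, i₂, i₃, τ, V, hcc, hV, hτV, hτj, -, u, hu⟩ :=
    exists_dilation_of_projection hP hPP hPc he hen fun x hx =>
      mul_eq_of_jordanMul_eq (hunit e he) (hunit x hx)
  have hiso : ∀ (n : ℕ) (a : Matrix (Fin n) (Fin n) (rangeSpace P)),
      ‖matOp (a.map τ)‖ = ‖subMatOp (rangeSpace P) a‖ := fun n a =>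
    le_antisymm (hcc n a) (norm_subMatOp_le_of_compression τ hV hτV a)
  have hnorm := norm_eq_of_norm_matOp_eq hiso
  have hinj : Function.Injective τ := (AddMonoidHomClass.isometry_of_norm τ hnorm).injective
  have hτm : ∀ x y, τ (newJordanMul hM P x y) = jordanMul (τ x) (τ y) := fun x y => by
    have h : (newJordanMul hM P x y : H →L[ℂ] H) = Q (jordanMul x y) := (hQP _).symm
    rw [jordanMul, hτj x y (newJordanMul hM P x y)
      (by rw [h, jordanMul, map_smul, smul_smul]; simp), smul_smul]
    simp
  refine ⟨K, i₁, i₂, i₃, LinearMap.range τ, LinearEquiv.ofInjective τ hinj,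
    ⟨isClosed_range_of_norm_eq hF hnorm, ?_, τ u, ⟨u, rfl⟩, ?_, ?_⟩,
    isCompletelyIsometric_ofInjective hinj hiso, hτm⟩
  · rintro _ ⟨x, rfl⟩ _ ⟨y, rfl⟩
    exact ⟨_, hτm x y⟩
  · rw [hu]
    exact ContinuousLinearMap.norm_id_le
  · intro x _
    rw [hu, jordanMul, one_mul, mul_one, ← two_smul ℂ x, smul_smul]
    simp

end ChoiEffros

/-! ### The mean ergodic projection onto the fixed points. -/

section MeanErgodic

variable {H : Type u} [NormedAddCommGroup H] [InnerProductSpace ℂ H] [CompleteSpace H]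
  {M : Submodule ℂ (H →L[ℂ] H)}

theorem IsWeakStarContinuous.wTendsto {Φ : M →ₗ[ℂ] M} (hΦ : IsWeakStarContinuous Φ) {α : Type*}
    {l : Filter α} {y : α → M} {y₀ : M} (h : WTendsto (fun t => (y t : H →L[ℂ] H)) l y₀) {C : ℝ}
    (hC : ∀ᶠ t in l, ‖(y t : H →L[ℂ] H)‖ ≤ C) :
    WTendsto (fun t => (Φ (y t) : H →L[ℂ] H)) l (Φ y₀) := by
  have h1 : Tendsto y l (@nhds M (relWeakStar M) y₀) := by
    rw [@nhds_induced _ _ (weakStar H), tendsto_comap_iff]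
    exact h.tendsto_weakStar hC
  have h2 := (@Continuous.tendsto _ _ (relWeakStar M) (relWeakStar M) _ hΦ y₀).comp h1
  rw [@nhds_induced _ _ (weakStar H), tendsto_comap_iff] at h2
  exact wTendsto_of_tendsto_weakStar h2

theorem WTendsto.congr' {α : Type*} {S T : α → H →L[ℂ] H} {l : Filter α} {T₀ : H →L[ℂ] H}
    (hT : WTendsto S l T₀) (h : S =ᶠ[l] T) : WTendsto T l T₀ := fun η ξ =>
  (hT η ξ).congr' (h.mono fun a ha => by rw [ha])

theorem isWeakStarClosed_fixedSpace (hM : IsWeakStarClosed M) {Φ : M →ₗ[ℂ] M}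
    (hΦ : IsWeakStarContinuous Φ) : IsWeakStarClosed (fixedSpace Φ) := by
  classical
  refine isWeakStarClosed_of_bounded fun 𝒰 T₀ r hb hT => ?_
  have hmem : ∀ᶠ T in (𝒰 : Filter (H →L[ℂ] H)), T ∈ M := by
    filter_upwards [hb] with T h
    obtain ⟨⟨x, -, rfl⟩, -⟩ := h
    exact x.2
  have hT₀ : T₀ ∈ M := hM.mem_of_wTendsto hT (hb.mono fun T h => h.2) hmem
  -- The default value `0` is irrelevant, since the ultrafilter is concentrated on `M`.
  let y : (H →L[ℂ] H) → M := fun T => if h : T ∈ M then ⟨T, h⟩ else 0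
  have hy : ∀ᶠ T in (𝒰 : Filter (H →L[ℂ] H)), (y T : H →L[ℂ] H) = T := by
    filter_upwards [hmem] with T h
    simp [y, h]
  have hΦy : ∀ᶠ T in (𝒰 : Filter (H →L[ℂ] H)), T = (Φ (y T) : H →L[ℂ] H) := by
    filter_upwards [hb, hy] with T h hyT
    obtain ⟨⟨x, hx, rfl⟩, -⟩ := h
    have : y (M.subtype x) = x := Subtype.ext hyT
    rw [this]
    exact congrArg Subtype.val (Eq.symm hx)
  have h1 := hΦ.wTendsto (y := y) (y₀ := ⟨T₀, hT₀⟩) (l := 𝒰) (C := r)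
    (hT.congr' (hy.mono fun T h => h.symm)) (by
      filter_upwards [hb, hy] with T h hyT
      rw [hyT]
      exact h.2)
  exact ⟨⟨T₀, hT₀⟩, Subtype.ext (h1.unique (hT.congr' hΦy)), rfl⟩

theorem subMatOp_add {n : ℕ} (a b : Matrix (Fin n) (Fin n) M) :
    subMatOp M (a + b) = subMatOp M a + subMatOp M b := by
  ext v i
  simp [subMatOp, matOp_apply, Finset.sum_add_distrib]

theorem subMatOp_smul {n : ℕ} (c : ℂ) (a : Matrix (Fin n) (Fin n) M) :
    subMatOp M (c • a) = c • subMatOp M a := by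
  ext v i
  simp [subMatOp, matOp_apply, Finset.smul_sum]

theorem IsRealPositive.smul_add {E : Type u} [NormedAddCommGroup E] [InnerProductSpace ℂ E]
    [CompleteSpace E] {S T : E →L[ℂ] E} (hS : IsRealPositive S) (hT : IsRealPositive T) {s t : ℝ}
    (hs : 0 ≤ s) (ht : 0 ≤ t) : IsRealPositive ((s : ℂ) • S + (t : ℂ) • T) := by
  rw [isRealPositive_iff] at *
  intro v
  have h1 := mul_nonneg hs (hS v)
  have h2 := mul_nonneg ht (hT v)
  simp only [add_apply, smul_apply, inner_add_right, inner_smul_right, Complex.add_re,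
    Complex.re_ofReal_mul]
  exact add_nonneg h1 h2

/-- The Cesàro means of the iterates of `Φ`. -/
def cesaro (Φ : M →ₗ[ℂ] M) : ℕ → (M →ₗ[ℂ] M)
  | 0 => LinearMap.id
  | n + 1 => (((n + 1 : ℝ) / (n + 2) : ℝ) : ℂ) • cesaro Φ n + ((1 / (n + 2) : ℝ) : ℂ) • Φ ^ (n + 1)

variable {Φ : M →ₗ[ℂ] M}

theorem isRealCompletelyPositive_pow (hΦ : IsRealCompletelyPositive Φ) (k : ℕ) :
    IsRealCompletelyPositive (Φ ^ k) := by
  induction k with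
  | zero => exact fun n a h => h
  | succ k ih =>
    intro n a h
    rw [pow_succ]
    exact ih n _ (hΦ n a h)

theorem isCompletelyContractive_pow (hΦ : IsCompletelyContractive Φ) (k : ℕ) :
    IsCompletelyContractive (Φ ^ k) := by
  induction k with
  | zero => exact fun n a => le_rfl
  | succ k ih =>
    intro n a
    rw [pow_succ]
    exact (ih n _).trans (hΦ n a)

theorem subMatOp_map_smul_add {n : ℕ} (a : Matrix (Fin n) (Fin n) M) (A B : M →ₗ[ℂ] M)
    (s t : ℂ) : subMatOp M (a.map ⇑(s • A + t • B)) =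
      s • subMatOp M (a.map A) + t • subMatOp M (a.map B) := by
  rw [← subMatOp_smul, ← subMatOp_smul, ← subMatOp_add]
  rfl

theorem isRealCompletelyPositive_cesaro (hΦ : IsRealCompletelyPositive Φ) (k : ℕ) :
    IsRealCompletelyPositive (cesaro Φ k) := by
  induction k with
  | zero => exact fun n a h => h
  | succ k ih =>
    intro n a h
    rw [cesaro, subMatOp_map_smul_add]
    exact (ih n a h).smul_add (isRealCompletelyPositive_pow hΦ _ n a h) (by positivity)
      (by positivity)

theorem isCompletelyContractive_cesaro (hΦ : IsCompletelyContractive Φ) (k : ℕ) :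
    IsCompletelyContractive (cesaro Φ k) := by
  induction k with
  | zero => exact fun n a => le_rfl
  | succ k ih =>
    intro n a
    rw [cesaro, subMatOp_map_smul_add]
    refine (norm_add_le _ _).trans ?_
    rw [norm_smul, norm_smul, Complex.norm_of_nonneg (by positivity),
      Complex.norm_of_nonneg (by positivity)]
    have h1 := ih n a
    have h2 := isCompletelyContractive_pow hΦ (k + 1) n a
    calc _ ≤ (k + 1 : ℝ) / (k + 2) * ‖subMatOp M a‖ + 1 / (k + 2) * ‖subMatOp M a‖ := by
          gcongr
      _ = ‖subMatOp M a‖ := by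
          field_simp
          ring

theorem cesaro_of_map_eq {x : M} (hx : Φ x = x) (k : ℕ) : cesaro Φ k x = x := by
  have hpow : ∀ k, (Φ ^ k) x = x := fun k => by
    induction k with
    | zero => rfl
    | succ k ih => rw [pow_succ, Module.End.mul_apply, hx, ih]
  induction k with
  | zero => rfl
  | succ k ih =>
    rw [cesaro, LinearMap.add_apply, LinearMap.smul_apply, LinearMap.smul_apply, ih, hpow,
      ← add_smul, ← Complex.ofReal_add]
    have : (k + 1 : ℝ) / (k + 2) + 1 / (k + 2) = 1 := by field_simp; ring
    rw [this, Complex.ofReal_one, one_smul]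

/-- Telescoping: `cesaro Φ k` averages the `k + 1` powers `Φ^0, …, Φ^k`. For contractive `Φ` it
follows that `Φ` moves the means by at most `2‖x‖/(k + 1)`. -/
theorem smul_map_cesaro_sub (k : ℕ) (x : M) :
    (k + 1 : ℂ) • (Φ (cesaro Φ k x) - cesaro Φ k x) = (Φ ^ (k + 1)) x - x := by
  induction k with
  | zero => simp [cesaro]
  | succ k ih =>
    have h2 : (k + 2 : ℂ) ≠ 0 := by
      have : ((k + 2 : ℕ) : ℂ) ≠ 0 := Nat.cast_ne_zero.2 (by omega)
      exact_mod_cast this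
    have h3 : (Φ ^ (k + 1 + 1)) x = Φ ((Φ ^ (k + 1)) x) := by
      rw [pow_succ' Φ (k + 1), Module.End.mul_apply]
    rw [cesaro, h3]
    simp only [LinearMap.add_apply, LinearMap.smul_apply, map_add, map_smul]
    push_cast
    have e1 : ((k : ℂ) + 1 + 1) * (((k : ℂ) + 1) / (k + 2)) = k + 1 := by field_simp; ring
    have e2 : ((k : ℂ) + 1 + 1) * (1 / (k + 2)) = 1 := by field_simp; ring
    rw [smul_sub, smul_add, smul_add, smul_smul, smul_smul, smul_smul, smul_smul, e1, e2, one_smul,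
      one_smul]
    rw [smul_sub] at ih
    rw [add_sub_add_comm, ih]
    abel

/-- A weak* continuous contractive map has a projection onto its fixed points that is a weak
limit of Cesàro means. -/
theorem exists_fixedSpace_projection (hM : IsWeakStarClosed M) (hΦw : IsWeakStarContinuous Φ)
    (hΦp : IsRealCompletelyPositive Φ) (hΦc : IsCompletelyContractive Φ) :
    ∃ P : M →ₗ[ℂ] M, P ∘ₗ P = P ∧ rangeSpace P = fixedSpace Φ ∧
      IsRealCompletelyPositive P ∧ IsCompletelyContractive P := by
  let 𝒰 : Ultrafilter ℕ := hyperfilter ℕ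
  have hbd : ∀ x, ∀ᶠ k in (𝒰 : Filter ℕ), ‖(cesaro Φ k x : H →L[ℂ] H)‖ ≤ ‖x‖ := fun x =>
    Eventually.of_forall fun k => (isCompletelyContractive_cesaro hΦc k).norm_map_le x
  have hex : ∀ x, ∃ y : M, WTendsto (fun k => (cesaro Φ k x : H →L[ℂ] H)) 𝒰 y := fun x => by
    obtain ⟨T, -, hT⟩ := exists_wTendsto 𝒰 (fun k => (cesaro Φ k x : H →L[ℂ] H)) (hbd x)
    exact ⟨⟨T, hM.mem_of_wTendsto hT (hbd x) (Eventually.of_forall fun k => (cesaro Φ k x).2)⟩, hT⟩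
  choose p hp using hex
  let P : M →ₗ[ℂ] M :=
    { toFun := p
      map_add' := fun x y => Subtype.ext ((hp (x + y)).unique (by
        simpa using (hp x).add (hp y)))
      map_smul' := fun c x => Subtype.ext ((hp (c • x)).unique (by
        simpa using (hp x).const_smul c)) }
  have hP : ∀ x, WTendsto (fun k => (cesaro Φ k x : H →L[ℂ] H)) 𝒰 (P x) := hp
  have hfix : ∀ x, Φ x = x → P x = x := fun x hx =>
    Subtype.ext ((hP x).unique (by simpa only [cesaro_of_map_eq hx] using wTendsto_const _ _))
  -- Weak* continuity moves `Φ` through the limit of the bounded means, and the telescoping bound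
  -- makes the difference tend to zero along the hyperfilter.
  have hΦP : ∀ x, Φ (P x) = P x := by
    intro x
    have h1 := (hΦw.wTendsto (hP x) (hbd x)).sub (hP x)
    have h2 : WTendsto
        (fun k => (Φ (cesaro Φ k x) : H →L[ℂ] H) - (cesaro Φ k x : H →L[ℂ] H)) 𝒰 0 := by
      intro η ξ
      rw [zero_apply, inner_zero_right]
      have hlim :
          Tendsto (fun k : ℕ => 1 / ((k : ℝ) + 1) * (2 * ‖x‖) * (‖η‖ * ‖ξ‖)) 𝒰 (𝓝 0) := by
        have := (tendsto_one_div_add_atTop_nhds_zero_nat (𝕜 := ℝ)).mono_left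
          Nat.hyperfilter_le_atTop
        simpa using (this.mul_const (2 * ‖x‖)).mul_const (‖η‖ * ‖ξ‖)
      refine squeeze_zero_norm (fun k => ?_) hlim
      refine (norm_inner_apply_le _ ?_ η ξ).trans_eq rfl
      have h3 := congrArg norm (smul_map_cesaro_sub (Φ := Φ) k x)
      have h4 : ‖(Φ ^ (k + 1)) x - x‖ ≤ 2 * ‖x‖ := by
        have := (isCompletelyContractive_pow hΦc (k + 1)).norm_map_le x
        linarith [norm_sub_le ((Φ ^ (k + 1)) x) x]
      have h5 : ‖(k + 1 : ℂ)‖ = k + 1 := by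
        exact_mod_cast Complex.norm_natCast (k + 1)
      rw [norm_smul, h5] at h3
      change ‖Φ (cesaro Φ k x) - cesaro Φ k x‖ ≤ _
      rw [one_div, inv_mul_eq_div, le_div_iff₀ (by positivity), mul_comm, h3]
      exact h4
    exact sub_eq_zero.1 (Subtype.ext (h1.unique h2))
  have hmat : ∀ (n : ℕ) (a : Matrix (Fin n) (Fin n) M),
      WTendsto (fun k => subMatOp M (a.map (cesaro Φ k))) 𝒰 (subMatOp M (a.map P)) := by
    intro n a η ξ
    simp only [PiLp.inner_apply, subMatOp, matOp_apply, inner_sum, Matrix.map_apply]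
    exact tendsto_finsetSum _ fun i _ => tendsto_finsetSum _ fun j _ => hP _ _ _
  refine ⟨P, LinearMap.ext fun x => hfix _ (hΦP x), ?_, fun n a h => ?_, fun n a => ?_⟩
  · ext T
    constructor
    · rintro ⟨x, rfl⟩
      exact ⟨P x, hΦP x, rfl⟩
    · rintro ⟨x, hx, rfl⟩
      exact ⟨x, congrArg Subtype.val (hfix x hx)⟩
  · rw [isRealPositive_iff]
    intro v
    refine ge_of_tendsto (((Complex.continuous_re.tendsto _).comp (hmat n a v v)))
      (Eventually.of_forall fun k => ?_)
    exact (isRealPositive_iff _).1 (isRealCompletelyPositive_cesaro hΦp k n a h) v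
  · exact (hmat n a).norm_le (Eventually.of_forall fun k =>
      isCompletelyContractive_cesaro hΦc k n a)

end MeanErgodic

end

end OperatorAlg

theorem corollary3p6 {H : Type*} [NormedAddCommGroup H] [InnerProductSpace ℂ H]
    [CompleteSpace H] (M : Submodule ℂ (H →L[ℂ] H)) (hMw : OperatorAlg.IsWeakStarClosed M)
    (Φ : M →ₗ[ℂ] M) (hΦw : OperatorAlg.IsWeakStarContinuous Φ)
    (hΦp : OperatorAlg.IsRealCompletelyPositive Φ)
    (hΦc : OperatorAlg.IsCompletelyContractive Φ) :
    (∀ hM : OperatorAlg.IsUnitalOperatorAlgebra M,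
      ∃ P : M →ₗ[ℂ] M, P ∘ₗ P = P ∧
        OperatorAlg.rangeSpace P = OperatorAlg.fixedSpace Φ ∧
        OperatorAlg.IsRealCompletelyPositive P ∧
        OperatorAlg.IsCompletelyContractive P ∧
        OperatorAlg.IsUnitalDualOperatorAlgebraWith (OperatorAlg.rangeSpace P)
          (OperatorAlg.newMul hM P)) ∧
    (∀ hM : OperatorAlg.IsUnitalJordanOperatorAlgebra M,
      ∃ P : M →ₗ[ℂ] M, P ∘ₗ P = P ∧
        OperatorAlg.rangeSpace P = OperatorAlg.fixedSpace Φ ∧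
        OperatorAlg.IsRealCompletelyPositive P ∧
        OperatorAlg.IsCompletelyContractive P ∧
        OperatorAlg.IsUnitalJordanOperatorAlgebraWith (OperatorAlg.rangeSpace P)
          (OperatorAlg.newJordanMul hM P)) := by
  obtain ⟨P, hPP, hPF, hPp, hPc⟩ := OperatorAlg.exists_fixedSpace_projection hMw hΦw hΦp hΦc
  have hF : OperatorAlg.IsWeakStarClosed (OperatorAlg.rangeSpace P) := by
    rw [hPF]
    exact OperatorAlg.isWeakStarClosed_fixedSpace hMw hΦw
  exact ⟨fun hM => ⟨P, hPP, hPF, hPp, hPc,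
      OperatorAlg.isUnitalDualOperatorAlgebraWith_newMul hM hPp hPP hPc hF⟩,
    fun hM => ⟨P, hPP, hPF, hPp, hPc,
      OperatorAlg.isUnitalJordanOperatorAlgebraWith_newJordanMul hM hPp hPP hPc hF⟩⟩
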